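/- Fix an integer $d\ge 2$ and $r\in\mathbb{C}$. Let $\hat{\mathfrak h}$ be the complex Lie algebra with basis $\{v^i(m) : 1\le i\le d,\ m\in\mathbb{Z}\}\cup\{\mathbf c\}$, $\mathbf c$ central, and $[v^i(m),v^j(n)]=\delta_{m+n,0}\,\delta_{i,j}\,m\,\mathbf c$. In the quotient algebra $U(\hat{\mathfrak h})/\langle \mathbf c-1\rangle$ put $v^{ij}(m,n):=v^i(m)v^j(n)$ and $$\mathcal B:=\{v^{ii}(m,n) : 1\le i\le d,\ m\le n\}\cup\{v^{ij}(m,n) : 1\le i<j\le d,\ m,n\in\mathbb{Z}\},\qquad \mathcal L:=\operatorname{Span}_{\mathbb C}\mathcal B\oplus\mathbb{C}1,$$ where $\mathcal B\cup\{1\}$ is linearly independent. The space $\mathcal L$ is closed under the commutator. Let $\pi_1:\mathcal L\to\operatorname{Span}_{\mathbb C}\mathcal B$ and $\pi_2:\mathcal L\to\mathbb{C}$ be the projections, and let $\mathcal L_r$ be the Lie algebra $\mathcal L$ with bracket $[x,y]_r:=\pi_1([x,y])+r\,\pi_2([x,y])$. Let $\mathcal B_+$ be the set of all $v^{ij}(m,n)\in\mathcal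 B$ with $m\ge 0$ or $n\ge 0$, and let $\mathcal L_r^+:=\operatorname{Span}_{\mathbb C}\mathcal B_+\oplus\mathbb{C}1$, a Lie subalgebra of $\mathcal L_r$. Let $\mathbb{C}\mathbf 1$ be the one-dimensional $\mathcal L_r^+$-module on which every element of $\mathcal B_+$ acts as $0$ and every $s\in\mathbb{C}\subset\mathcal L_r^+$ acts as multiplication by $s$. Let $M_r:=U(\mathcal L_r)\otimes_{U(\mathcal L_r^+)}\mathbb{C}\mathbf 1$ be the induced $\mathcal L_r$-module. Finally, let $\mathcal L_r^{(1)}$ be the Lie subalgebra of $\mathcal L_r$ generated by all $v^{11}(m,n)$ with $m,n\in\mathbb{Z}$, $m\le n$, and let $M_r^{(1)}:=U(\mathcal L_r^{(1)})\mathbf 1\subset M_r$. **Proposition.** The $\mathcal L_r$-module $M_r$ is irreducible if and only if $M_r^{(1)}$ is irreducible as an $\mathcal L_r^{(1)}$-module. -/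

import Mathlib

namespace AshiharaMiyamoto

noncomputable section

attribute [local instance 100] LieRing.ofAssociativeRing

/-! ## The Heisenberg Lie algebra -/

/-- The labels `(i, m)` of the Heisenberg generators `v^i(m)`, `1 ≤ i ≤ d`, `m ∈ ℤ`. -/
abbrev Gen (d : ℕ) : Type := Fin d × ℤ

/-- The vector space with basis `{v^i(m)} ∪ {c}`. The first component collects the coordinates
along the `v^i(m)`, the second one is the coordinate along the central element `c`. -/
def Heis (d : ℕ) : Type := (Gen d →₀ ℂ) × ℂ

instance (d : ℕ) : AddCommGroup (Heis d) := inferInstanceAs (AddCommGroup ((Gen d →₀ ℂ) × ℂ))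

instance (d : ℕ) : Module ℂ (Heis d) := inferInstanceAs (Module ℂ ((Gen d →₀ ℂ) × ℂ))

/-- The basis vector `v^i(m)` of the Heisenberg Lie algebra. -/
def heisV {d : ℕ} (i : Fin d) (m : ℤ) : Heis d := (Finsupp.single (i, m) 1, 0)

/-- The central basis vector `c` of the Heisenberg Lie algebra. -/
def heisC (d : ℕ) : Heis d := (0, 1)

/-- The bilinear form with `form (v^i(m)) (v^j(n)) = δ_{m+n,0} δ_{i,j} m`. -/
def form (d : ℕ) : (Gen d →₀ ℂ) →ₗ[ℂ] (Gen d →₀ ℂ) →ₗ[ℂ] ℂ :=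
  Finsupp.linearCombination ℂ fun p : Gen d => (p.2 : ℂ) • Finsupp.lapply (p.1, -p.2)

theorem form_single {d : ℕ} (p q : Gen d) :
    form d (Finsupp.single p 1) (Finsupp.single q 1) =
      if p.2 + q.2 = 0 ∧ p.1 = q.1 then (p.2 : ℂ) else 0 := by
  obtain ⟨i, m⟩ := p
  obtain ⟨j, n⟩ := q
  simp only [form, Finsupp.linearCombination_single, one_smul, LinearMap.smul_apply,
    Finsupp.lapply_apply, Finsupp.single_apply, Prod.mk.injEq, smul_eq_mul, mul_ite, mul_one,
    mul_zero]
  congr 1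
  apply propext
  constructor
  · rintro ⟨h1, h2⟩
    exact ⟨by omega, h1.symm⟩
  · rintro ⟨h1, h2⟩
    exact ⟨h2.symm, by omega⟩

theorem form_skew {d : ℕ} (f g : Gen d →₀ ℂ) : form d f g = -form d g f := by
  have h : form d = -(form d).flip := by
    refine Finsupp.lhom_ext' fun p => LinearMap.ext_ring ?_
    refine Finsupp.lhom_ext' fun q => LinearMap.ext_ring ?_
    simp only [LinearMap.coe_comp, Function.comp_apply, Finsupp.lsingle_apply,
      LinearMap.neg_apply, LinearMap.flip_apply]
    rw [form_single, form_single]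
    by_cases h : p.2 + q.2 = 0 ∧ p.1 = q.1
    · rw [if_pos h, if_pos ⟨by omega, h.2.symm⟩]
      have : p.2 = -q.2 := by omega
      rw [this]
      push_cast
      rfl
    · rw [if_neg h, if_neg (fun h' => h ⟨by omega, h'.2.symm⟩), neg_zero]
  exact congrArg (fun B => B f g) h

theorem form_self {d : ℕ} (f : Gen d →₀ ℂ) : form d f f = 0 := by
  have h := form_skew f f
  linear_combination (1 / 2 : ℂ) * h

/-- The bracket of the Heisenberg Lie algebra, see `heis_lie_v` and `heis_lie_c`. -/
instance (d : ℕ) : LieRing (Heis d) where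
  bracket x y := (0, form d x.1 y.1)
  add_lie x y z := Prod.ext (add_zero (0 : Gen d →₀ ℂ)).symm (by
    change form d (x.1 + y.1) z.1 = form d x.1 z.1 + form d y.1 z.1
    rw [map_add, LinearMap.add_apply])
  lie_add x y z := Prod.ext (add_zero (0 : Gen d →₀ ℂ)).symm (by
    change form d x.1 (y.1 + z.1) = form d x.1 y.1 + form d x.1 z.1
    rw [map_add])
  lie_self x := Prod.ext rfl (form_self x.1)
  leibniz_lie x y z := Prod.ext (add_zero (0 : Gen d →₀ ℂ)).symm (by
    change form d x.1 0 = form d 0 z.1 + form d y.1 0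
    simp)

instance (d : ℕ) : LieAlgebra ℂ (Heis d) where
  lie_smul t x y := Prod.ext (smul_zero t).symm (by
    change form d x.1 (t • y.1) = t • form d x.1 y.1
    rw [map_smul])

theorem heis_lie_v {d : ℕ} (i j : Fin d) (m n : ℤ) :
    ⁅heisV i m, heisV j n⁆ = if m + n = 0 ∧ i = j then (m : ℂ) • heisC d else 0 := by
  have h : ⁅heisV i m, heisV j n⁆ = ((0, if m + n = 0 ∧ i = j then (m : ℂ) else 0) : Heis d) :=
    Prod.ext rfl (form_single (i, m) (j, n))
  rw [h]
  split_ifs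
  · exact Prod.ext (smul_zero _).symm (mul_one _).symm
  · rfl

theorem heis_lie_c {d : ℕ} (x : Heis d) : ⁅heisC d, x⁆ = 0 :=
  Prod.ext rfl (by change form d 0 x.1 = 0; simp)

/-! ## The quotient algebra `U(ĥ) / ⟨c - 1⟩` -/

/-- `U(ĥ) / ⟨c - 1⟩`: the quotient of the enveloping algebra by the smallest two-sided congruence
that identifies `c` with `1`. -/
abbrev Weyl (d : ℕ) : Type :=
  RingQuot fun a b : UniversalEnvelopingAlgebra ℂ (Heis d) =>
    a = UniversalEnvelopingAlgebra.ι ℂ (heisC d) ∧ b = 1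

/-- The natural map from the Heisenberg Lie algebra to `U(ĥ) / ⟨c - 1⟩`. -/
def toWeyl (d : ℕ) : Heis d →ₗ[ℂ] Weyl d :=
  (RingQuot.mkAlgHom ℂ _).toLinearMap ∘ₗ
    (UniversalEnvelopingAlgebra.ι ℂ : Heis d →ₗ⁅ℂ⁆ _).toLinearMap

/-- The image of `v^i(m)` in `U(ĥ) / ⟨c - 1⟩`. -/
def wV {d : ℕ} (i : Fin d) (m : ℤ) : Weyl d := toWeyl d (heisV i m)

/-- `v^{ij}(m, n) = v^i(m) v^j(n)` in `U(ĥ) / ⟨c - 1⟩`. -/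
def v {d : ℕ} (i j : Fin d) (m n : ℤ) : Weyl d := wV i m * wV j n

theorem toWeyl_heisC (d : ℕ) : toWeyl d (heisC d) = 1 := by
  have h := RingQuot.mkAlgHom_rel ℂ
    (s := fun a b : UniversalEnvelopingAlgebra ℂ (Heis d) =>
      a = UniversalEnvelopingAlgebra.ι ℂ (heisC d) ∧ b = 1)
    (x := UniversalEnvelopingAlgebra.ι ℂ (heisC d)) (y := 1) ⟨rfl, rfl⟩
  rw [map_one] at h
  exact h

theorem toWeyl_lie {d : ℕ} (x y : Heis d) :
    toWeyl d ⁅x, y⁆ = toWeyl d x * toWeyl d y - toWeyl d y * toWeyl d x := by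
  simp only [toWeyl, LinearMap.comp_apply, LieHom.coe_toLinearMap, LieHom.map_lie,
    LieRing.of_associative_ring_bracket, AlgHom.toLinearMap_apply, map_sub, map_mul]

/-- The Heisenberg commutation relations in `U(ĥ) / ⟨c - 1⟩`. -/
theorem wV_comm {d : ℕ} (i j : Fin d) (m n : ℤ) :
    wV i m * wV j n - wV j n * wV i m =
      (if m + n = 0 ∧ i = j then (m : ℂ) else 0) • (1 : Weyl d) := by
  rw [wV, wV, ← toWeyl_lie, heis_lie_v]
  split_ifs
  · rw [map_smul, toWeyl_heisC]
  · simp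

/-! ## The space `𝓛 = Span 𝓑 ⊕ ℂ` -/

/-- The index condition of the set `𝓑`: either `i < j`, or `i = j` and `m ≤ n`. -/
def Canon {d : ℕ} (i j : Fin d) (m n : ℤ) : Prop := i < j ∨ (i = j ∧ m ≤ n)

/-- The set `𝓑` of all `v^{ii}(m, n)` with `m ≤ n` and all `v^{ij}(m, n)` with `i < j`. -/
def setB (d : ℕ) : Set (Weyl d) := {x | ∃ i j m n, Canon i j m n ∧ x = v i j m n}

/-- The set `𝓑₊` of all `v^{ij}(m, n) ∈ 𝓑` with `m ≥ 0` or `n ≥ 0`. -/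
def setBPlus (d : ℕ) : Set (Weyl d) :=
  {x | ∃ i j m n, Canon i j m n ∧ (0 ≤ m ∨ 0 ≤ n) ∧ x = v i j m n}

/-- The space `𝓛 = Span 𝓑 + ℂ 1` (the sum is direct, see `isCompl_spanB`). -/
def calL (d : ℕ) : Submodule ℂ (Weyl d) :=
  Submodule.span ℂ (setB d) ⊔ Submodule.span ℂ {1}

theorem one_mem_calL (d : ℕ) : (1 : Weyl d) ∈ calL d :=
  Submodule.mem_sup_right (Submodule.mem_span_singleton_self 1)

theorem v_mem_calL {d : ℕ} (i j : Fin d) (m n : ℤ) : v i j m n ∈ calL d := by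
  have key : ∀ (i j : Fin d) (m n : ℤ), Canon i j m n → v i j m n ∈ calL d := fun i j m n h =>
    Submodule.mem_sup_left (Submodule.subset_span ⟨i, j, m, n, h, rfl⟩)
  by_cases h : Canon i j m n
  · exact key i j m n h
  · have h' : Canon j i n m := by
      unfold Canon at h ⊢
      rcases lt_trichotomy i j with h1 | h1 | h1
      · exact absurd (Or.inl h1) h
      · exact Or.inr ⟨h1.symm, by by_contra h2; exact h (Or.inr ⟨h1, by omega⟩)⟩
      · exact Or.inl h1
    have e : v i j m n = v j i n m + (if m + n = 0 ∧ i = j then (m : ℂ) else 0) • (1 : Weyl d) := by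
      rw [← wV_comm, v, v]
      abel
    rw [e]
    exact (calL d).add_mem (key j i n m h') ((calL d).smul_mem _ (one_mem_calL d))

theorem calL_eq_span (d : ℕ) :
    calL d = Submodule.span ℂ ({x | ∃ i j m n, x = v i j m n} ∪ {1}) := by
  apply le_antisymm
  · refine sup_le (Submodule.span_mono ?_) (Submodule.span_mono Set.subset_union_right)
    rintro x ⟨i, j, m, n, -, rfl⟩
    exact Or.inl ⟨i, j, m, n, rfl⟩
  · rw [Submodule.span_le]
    rintro x (⟨i, j, m, n, rfl⟩ | rfl)
    · exact v_mem_calL i j m n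
    · exact one_mem_calL d

theorem comm_mem_calL {d : ℕ} {x y : Weyl d} (hx : x ∈ calL d) (hy : y ∈ calL d) :
    x * y - y * x ∈ calL d := by
  rw [calL_eq_span] at hx hy
  induction hx, hy using Submodule.span_induction₂ with
  | mem_mem x y hx hy =>
    rcases hx with ⟨i, j, m, n, rfl⟩ | rfl
    · rcases hy with ⟨k, l, s, t, rfl⟩ | rfl
      · have e : v i j m n * v k l s t - v k l s t * v i j m n =
            wV i m * (wV j n * wV k s - wV k s * wV j n) * wV l t +
            (wV i m * wV k s - wV k s * wV i m) * wV j n * wV l t +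
            wV k s * wV i m * (wV j n * wV l t - wV l t * wV j n) +
            wV k s * (wV i m * wV l t - wV l t * wV i m) * wV j n := by
          simp only [v]
          noncomm_ring
        rw [e]
        simp only [wV_comm, smul_mul_assoc, mul_smul_comm, mul_one, one_mul]
        exact (calL d).add_mem ((calL d).add_mem ((calL d).add_mem
          ((calL d).smul_mem _ (v_mem_calL i l m t)) ((calL d).smul_mem _ (v_mem_calL j l n t)))
          ((calL d).smul_mem _ (v_mem_calL k i s m))) ((calL d).smul_mem _ (v_mem_calL k j s n))
      · simp
    · simp
  | zero_left y hy => simp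
  | zero_right x hx => simp
  | add_left x y z _ _ _ h1 h2 =>
    have e : (x + y) * z - z * (x + y) = (x * z - z * x) + (y * z - z * y) := by noncomm_ring
    rw [e]
    exact (calL d).add_mem h1 h2
  | add_right x y z _ _ _ h1 h2 =>
    have e : x * (y + z) - (y + z) * x = (x * y - y * x) + (x * z - z * x) := by noncomm_ring
    rw [e]
    exact (calL d).add_mem h1 h2
  | smul_left r x y _ _ h =>
    have e : (r • x) * y - y * (r • x) = r • (x * y - y * x) := by
      rw [smul_mul_assoc, mul_smul_comm, smul_sub]
    rw [e]
    exact (calL d).smul_mem r h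
  | smul_right r x y _ _ h =>
    have e : x * (r • y) - (r • y) * x = r • (x * y - y * x) := by
      rw [smul_mul_assoc, mul_smul_comm, smul_sub]
    rw [e]
    exact (calL d).smul_mem r h

/-! ## Auxiliary Fock-type representations

They are only used to prove that the sum `Span 𝓑 + ℂ 1` is direct and that `Span 𝓑₊ ⊕ ℂ` is
closed under the bracket. -/

section Fock

open MvPolynomial

/-- The derivation of the polynomial ring attached to the label `p`. -/
def fockD {d : ℕ} (p : Gen d) : Derivation ℂ (MvPolynomial (Gen d) ℂ) (MvPolynomial (Gen d) ℂ) :=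
  mkDerivation ℂ fun q =>
    C (if 0 ≤ p.2 then form d (Finsupp.single p 1) (Finsupp.single q 1) else 0)

/-- The operator attached to the label `p`; the multiplication part of the operators of
non-negative mode is scaled by `e`. -/
def fockOp {d : ℕ} (e : ℂ) (p : Gen d) : Module.End ℂ (MvPolynomial (Gen d) ℂ) :=
  (if 0 ≤ p.2 then e else 1) • LinearMap.mulLeft ℂ (X p) + (fockD p).toLinearMap

theorem fockOp_apply {d : ℕ} (e : ℂ) (p : Gen d) (f : MvPolynomial (Gen d) ℂ) :
    fockOp e p f = (if 0 ≤ p.2 then e else 1) • (X p * f) + fockD p f := rfl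

theorem fockD_X {d : ℕ} (p q : Gen d) : fockD p (X q) =
    C (if 0 ≤ p.2 then form d (Finsupp.single p 1) (Finsupp.single q 1) else 0) :=
  mkDerivation_X _ _ _

theorem fockD_comm {d : ℕ} (p q : Gen d) (f : MvPolynomial (Gen d) ℂ) :
    fockD p (fockD q f) = fockD q (fockD p f) := by
  have h : ⁅fockD p, fockD q⁆ = 0 := by
    refine MvPolynomial.derivation_ext fun s => ?_
    rw [Derivation.commutator_apply, fockD_X, fockD_X, derivation_C, derivation_C]
    simp
  have h2 := congrArg (fun D => D f) h
  simp only [Derivation.commutator_apply, Derivation.coe_zero, Pi.zero_apply] at h2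
  exact sub_eq_zero.mp h2

theorem fockOp_comm {d : ℕ} (e : ℂ) (p q : Gen d) :
    fockOp e p * fockOp e q - fockOp e q * fockOp e p =
      form d (Finsupp.single p 1) (Finsupp.single q 1) • 1 := by
  refine LinearMap.ext fun f => ?_
  have hs : form d (Finsupp.single q 1) (Finsupp.single p 1) =
    -form d (Finsupp.single p 1) (Finsupp.single q 1) := form_skew _ _
  have hv : (0 ≤ p.2 ∧ 0 ≤ q.2) ∨ (¬ 0 ≤ p.2 ∧ ¬ 0 ≤ q.2) →
      form d (Finsupp.single p 1) (Finsupp.single q 1) = 0 := by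
    intro h
    rw [form_single]
    split_ifs with h'
    · have : p.2 = 0 := by omega
      simp [this]
    · rfl
  simp only [LinearMap.sub_apply, Module.End.mul_apply, fockOp_apply, map_add, map_smul,
    Derivation.leibniz, fockD_X, smul_eq_mul, LinearMap.smul_apply, Module.End.one_apply,
    fockD_comm q p f, hs]
  generalize form d (Finsupp.single p 1) (Finsupp.single q 1) = w at *
  simp only [MvPolynomial.smul_eq_C_mul]
  by_cases hp : 0 ≤ p.2 <;> by_cases hq : 0 ≤ q.2
  · rw [hv (Or.inl ⟨hp, hq⟩)]
    simp only [hp, hq, if_true, map_zero, neg_zero]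
    ring
  · simp only [hp, hq, if_true, if_false, map_zero, map_one]
    ring
  · simp only [hp, hq, if_true, if_false, map_zero, map_one, map_neg]
    ring
  · rw [hv (Or.inr ⟨hp, hq⟩)]
    simp only [hp, hq, if_false, map_zero, map_one]
    ring

/-- The linear extension of `fockOp` to the span of the `v^i(m)`. -/
def fockLin (d : ℕ) (e : ℂ) : (Gen d →₀ ℂ) →ₗ[ℂ] Module.End ℂ (MvPolynomial (Gen d) ℂ) :=
  Finsupp.linearCombination ℂ (fockOp e)

theorem fockLin_comm {d : ℕ} (e : ℂ) (f g : Gen d →₀ ℂ) :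
    fockLin d e f * fockLin d e g - fockLin d e g * fockLin d e f = form d f g • 1 := by
  induction f using Finsupp.induction_linear with
  | zero => simp
  | add f f' h h' =>
    rw [map_add, map_add, LinearMap.add_apply, add_smul, ← h, ← h']
    noncomm_ring
  | single p a =>
    induction g using Finsupp.induction_linear with
    | zero => simp
    | add f f' h h' =>
      rw [map_add, map_add, add_smul, ← h, ← h']
      noncomm_ring
    | single q b =>
      have ep : Finsupp.single p a = a • Finsupp.single p (1 : ℂ) := by simp
      have eq : Finsupp.single q b = b • Finsupp.single q (1 : ℂ) := by simp
      rw [ep, eq]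
      simp only [map_smul, LinearMap.smul_apply, fockLin, Finsupp.linearCombination_single,
        one_smul, smul_mul_assoc, mul_smul_comm, smul_eq_mul]
      have h := congrArg (fun T => (a * b) • T) (fockOp_comm e p q)
      simp only [sub_eq_add_neg, smul_add, smul_neg, smul_smul] at h ⊢
      rw [mul_comm b a, ← mul_assoc, mul_comm b a, h]

/-- The representation of the Heisenberg Lie algebra on polynomials. -/
def fockHeis (d : ℕ) (e : ℂ) : Heis d →ₗ⁅ℂ⁆ Module.End ℂ (MvPolynomial (Gen d) ℂ) where
  toFun x := fockLin d e x.1 + x.2 • 1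
  map_add' x y := by
    change fockLin d e (x.1 + y.1) + (x.2 + y.2) • 1 = _
    rw [map_add, add_smul]
    abel
  map_smul' t x := by
    change fockLin d e (t • x.1) + (t • x.2) • 1 = _
    rw [map_smul, RingHom.id_apply, smul_add, smul_assoc]
  map_lie' := by
    rintro ⟨f, a⟩ ⟨g, b⟩
    change fockLin d e 0 + form d f g • 1 =
      (fockLin d e f + a • 1) * (fockLin d e g + b • 1) -
        (fockLin d e g + b • 1) * (fockLin d e f + a • 1)
    rw [map_zero, zero_add, ← fockLin_comm e]
    simp only [add_mul, mul_add, smul_mul_assoc, mul_smul_comm, one_mul, mul_one, smul_add]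
    rw [smul_comm b a]
    abel

/-- The representation of `U(ĥ) / ⟨c - 1⟩` on polynomials. -/
def fockAlg (d : ℕ) (e : ℂ) : Weyl d →ₐ[ℂ] Module.End ℂ (MvPolynomial (Gen d) ℂ) :=
  RingQuot.liftAlgHom ℂ ⟨UniversalEnvelopingAlgebra.lift ℂ (fockHeis d e), by
    rintro a b ⟨rfl, rfl⟩
    rw [UniversalEnvelopingAlgebra.lift_ι_apply, map_one]
    change fockLin d e 0 + (1 : ℂ) • 1 = 1
    simp⟩

theorem fockAlg_wV {d : ℕ} (e : ℂ) (i : Fin d) (m : ℤ) :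
    fockAlg d e (wV i m) = fockOp e (i, m) := by
  have h : fockAlg d e (wV i m) = fockHeis d e (heisV i m) := by
    rw [wV, toWeyl, fockAlg, LinearMap.comp_apply, AlgHom.toLinearMap_apply,
      RingQuot.liftAlgHom_mkAlgHom_apply, LieHom.coe_toLinearMap,
      UniversalEnvelopingAlgebra.lift_ι_apply]
  rw [h]
  change fockLin d e (Finsupp.single (i, m) 1) + (0 : ℂ) • 1 = _
  simp [fockLin]

/-- The value of an element of `U(ĥ) / ⟨c - 1⟩` on the constant polynomial `1`. -/
def fockVal (d : ℕ) (e : ℂ) : Weyl d →ₗ[ℂ] MvPolynomial (Gen d) ℂ :=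
  LinearMap.applyₗ (1 : MvPolynomial (Gen d) ℂ) ∘ₗ (fockAlg d e).toLinearMap

theorem fockVal_apply {d : ℕ} (e : ℂ) (x : Weyl d) : fockVal d e x = fockAlg d e x 1 := rfl

theorem fockVal_one (d : ℕ) (e : ℂ) : fockVal d e 1 = 1 := by
  rw [fockVal_apply, map_one (fockAlg d e), Module.End.one_apply]

theorem fockVal_v {d : ℕ} (e : ℂ) {i j : Fin d} {m n : ℤ} (h : Canon i j m n) :
    fockVal d e (v i j m n) =
      ((if 0 ≤ m then e else 1) * (if 0 ≤ n then e else 1)) • (X (i, m) * X (j, n)) := by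
  rw [fockVal_apply, v, map_mul, fockAlg_wV, fockAlg_wV, Module.End.mul_apply, fockOp_apply,
    fockOp_apply, Derivation.map_one_eq_zero, mul_one, add_zero, Derivation.map_smul, fockD_X]
  have hz : (if 0 ≤ m then form d (Finsupp.single (i, m) 1) (Finsupp.single (j, n) 1) else 0)
      = 0 := by
    split_ifs with hm
    · rw [form_single]
      split_ifs with h'
      · simp only at h'
        rcases h with h | h
        · exact absurd h'.2 h.ne
        · have : m = 0 := by omega
          simp [this]
      · rfl
    · rfl
  simp only [hz, map_zero, smul_zero, add_zero, mul_smul_comm, smul_smul]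

theorem coeff_zero_fockVal {d : ℕ} (e : ℂ) {x : Weyl d} (hx : x ∈ Submodule.span ℂ (setB d)) :
    constantCoeff (fockVal d e x) = 0 := by
  induction hx using Submodule.span_induction with
  | mem x hx =>
    obtain ⟨i, j, m, n, h, rfl⟩ := hx
    rw [fockVal_v e h, constantCoeff_smul]
    simp
  | zero => simp
  | add x y _ _ hx hy => rw [map_add, map_add, hx, hy, add_zero]
  | smul t x _ hx => rw [map_smul, constantCoeff_smul, hx, smul_zero]

/-- The family `𝓑`, indexed by its labels. -/
def famB (d : ℕ) (a : {a : Gen d × Gen d // Canon a.1.1 a.2.1 a.1.2 a.2.2}) : Weyl d :=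
  v a.1.1.1 a.1.2.1 a.1.1.2 a.1.2.2

theorem range_famB (d : ℕ) : Set.range (famB d) = setB d := by
  ext x
  constructor
  · rintro ⟨⟨⟨⟨i, m⟩, ⟨j, n⟩⟩, h⟩, rfl⟩
    exact ⟨i, j, m, n, h, rfl⟩
  · rintro ⟨i, j, m, n, h, rfl⟩
    exact ⟨⟨((i, m), (j, n)), h⟩, rfl⟩

theorem linearIndependent_fockVal_famB (d : ℕ) :
    LinearIndependent ℂ (fun a => fockVal d 1 (famB d a)) := by
  have hinj : Function.Injective
      (fun a : {a : Gen d × Gen d // Canon a.1.1 a.2.1 a.1.2 a.2.2} =>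
        (Finsupp.single a.1.1 1 + Finsupp.single a.1.2 1 : Gen d →₀ ℕ)) := by
    rintro ⟨⟨⟨i, m⟩, ⟨j, n⟩⟩, h⟩ ⟨⟨⟨i', m'⟩, ⟨j', n'⟩⟩, h'⟩ e
    simp only at e
    rw [Finsupp.single_add_single_eq_single_add_single one_ne_zero one_ne_zero] at e
    simp only [Canon] at h h'
    apply Subtype.ext
    simp only [Prod.mk.injEq] at e ⊢
    rcases e with e | e | e
    · exact ⟨e.1, e.2⟩
    · obtain ⟨-, ⟨h1, h2⟩, ⟨h3, h4⟩⟩ := e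
      subst h1 h2 h3 h4
      rcases h with h | h <;> rcases h' with h' | h'
      · exact absurd h h'.asymm
      · exact absurd h'.1 h.ne'
      · exact absurd h.1 h'.ne'
      · obtain ⟨rfl, h1⟩ := h
        have : m = n := le_antisymm h1 h'.2
        subst this
        simp
    · simp at e
  have := (MvPolynomial.basisMonomials (Gen d) ℂ).linearIndependent.comp _ hinj
  have hfun : (fun a => fockVal d 1 (famB d a)) = MvPolynomial.basisMonomials (Gen d) ℂ ∘
      fun a => (Finsupp.single a.1.1 1 + Finsupp.single a.1.2 1 : Gen d →₀ ℕ) := by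
    funext a
    obtain ⟨⟨⟨i, m⟩, ⟨j, n⟩⟩, h⟩ := a
    simp only [famB, Function.comp_apply, coe_basisMonomials]
    rw [fockVal_v 1 h, ite_self, ite_self, mul_one, one_smul, X, X, monomial_mul, mul_one]
  rw [hfun]
  exact this

theorem fockVal_injOn {d : ℕ} {x : Weyl d} (hx : x ∈ Submodule.span ℂ (setB d))
    (h : fockVal d 1 x = 0) : x = 0 := by
  rw [← range_famB, Finsupp.mem_span_range_iff_exists_finsupp] at hx
  obtain ⟨c, rfl⟩ := hx
  have h2 : Finsupp.linearCombination ℂ (fun a => fockVal d 1 (famB d a)) c = 0 := by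
    rw [← h, map_finsuppSum, Finsupp.linearCombination_apply]
    simp only [map_smul]
  have h3 : c = 0 := linearIndependent_iff.mp (linearIndependent_fockVal_famB d) c h2
  simp [h3]

end Fock

/-- `𝓑 ∪ {1}` is linearly independent: here, the elements of `𝓑` with distinct labels. -/
theorem linearIndependent_famB (d : ℕ) : LinearIndependent ℂ (famB d) :=
  LinearIndependent.of_comp (fockVal d 1) (linearIndependent_fockVal_famB d)

/-! ## The projections `π₁`, `π₂` and the Lie algebra `𝓛_r` -/

/-- `Span 𝓑` as a subspace of `𝓛`. -/
def spanB (d : ℕ) : Submodule ℂ (calL d) :=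
  (Submodule.span ℂ (setB d)).comap (calL d).subtype

/-- The element `1` of `𝓛`. -/
def oneL (d : ℕ) : calL d := ⟨1, one_mem_calL d⟩

theorem oneL_ne_zero (d : ℕ) : oneL d ≠ 0 := by
  intro h
  have h1 : (1 : Weyl d) = 0 := congrArg Subtype.val h
  have h2 := fockVal_one d 1
  rw [h1, map_zero] at h2
  exact zero_ne_one h2

/-- The direct sum decomposition `𝓛 = Span 𝓑 ⊕ ℂ`. -/
theorem isCompl_spanB (d : ℕ) : IsCompl (spanB d) (Submodule.span ℂ {oneL d}) := by
  constructor
  · rw [Submodule.disjoint_def]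
    intro x hx hx'
    obtain ⟨s, rfl⟩ := Submodule.mem_span_singleton.mp hx'
    have h := coeff_zero_fockVal 1 (x := s • 1) hx
    rw [map_smul, fockVal_one, MvPolynomial.constantCoeff_smul, map_one, smul_eq_mul, mul_one] at h
    rw [h, zero_smul]
  · rw [codisjoint_iff, eq_top_iff]
    rintro ⟨x, hx⟩ -
    obtain ⟨y, hy, z, hz, rfl⟩ := Submodule.mem_sup.mp hx
    obtain ⟨s, rfl⟩ := Submodule.mem_span_singleton.mp hz
    exact Submodule.mem_sup.mpr ⟨⟨y, Submodule.mem_sup_left hy⟩, hy, s • oneL d,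
      Submodule.smul_mem _ _ (Submodule.mem_span_singleton_self _), rfl⟩

/-- The projection `π₁ : 𝓛 → Span 𝓑 ⊆ 𝓛` along `ℂ`. -/
def pi1 (d : ℕ) : calL d →ₗ[ℂ] calL d :=
  (spanB d).subtype ∘ₗ Submodule.projectionOnto _ _ (isCompl_spanB d)

/-- The projection `π₂ : 𝓛 → ℂ` along `Span 𝓑`. -/
def pi2 (d : ℕ) : calL d →ₗ[ℂ] ℂ :=
  (LinearEquiv.coord ℂ (calL d) (oneL d) (oneL_ne_zero d)).toLinearMap ∘ₗ
    Submodule.projectionOnto _ _ (isCompl_spanB d).symm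

theorem pi2_of_mem {d : ℕ} {x : calL d} (hx : x ∈ spanB d) : pi2 d x = 0 := by
  rw [pi2, LinearMap.comp_apply,
    Submodule.projectionOnto_apply_right (isCompl_spanB d).symm ⟨x, hx⟩, map_zero]

theorem pi2_one (d : ℕ) : pi2 d (oneL d) = 1 := by
  have h := Submodule.projectionOnto_apply_left (isCompl_spanB d).symm
    ⟨oneL d, Submodule.mem_span_singleton_self _⟩
  rw [pi2, LinearMap.comp_apply, h]
  exact LinearEquiv.coord_self ℂ (calL d) (oneL d) (oneL_ne_zero d)

theorem pi1_add_pi2 {d : ℕ} (x : calL d) : pi1 d x + pi2 d x • oneL d = x := by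
  have h : x ∈ spanB d ⊔ Submodule.span ℂ {oneL d} := by
    rw [(isCompl_spanB d).sup_eq_top]
    trivial
  obtain ⟨y, hy, z, hz, rfl⟩ := Submodule.mem_sup.mp h
  obtain ⟨s, rfl⟩ := Submodule.mem_span_singleton.mp hz
  have h1 : pi1 d y = y := by
    rw [pi1, LinearMap.comp_apply,
      Submodule.projectionOnto_apply_left (isCompl_spanB d) ⟨y, hy⟩]
    rfl
  have h2 : pi1 d (oneL d) = 0 := by
    rw [pi1, LinearMap.comp_apply, Submodule.projectionOnto_apply_right (isCompl_spanB d)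
      ⟨oneL d, Submodule.mem_span_singleton_self _⟩, map_zero]
  rw [map_add, map_add, map_smul, map_smul, h1, h2, pi2_of_mem hy, pi2_one]
  simp

/-- The commutator of two elements of `𝓛`, taken in `U(ĥ) / ⟨c - 1⟩`. -/
def comm {d : ℕ} (x y : calL d) : calL d :=
  ⟨(x : Weyl d) * y - (y : Weyl d) * x, comm_mem_calL x.2 y.2⟩

theorem comm_add_left {d : ℕ} (x y z : calL d) : comm (x + y) z = comm x z + comm y z := by
  apply Subtype.ext
  simp only [comm, Submodule.coe_add]
  noncomm_ring

theorem comm_skew {d : ℕ} (x y : calL d) : comm x y = -comm y x := by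
  apply Subtype.ext
  simp [comm]

theorem comm_self {d : ℕ} (x : calL d) : comm x x = 0 := Subtype.ext (sub_self _)

theorem comm_add_right {d : ℕ} (x y z : calL d) : comm x (y + z) = comm x y + comm x z := by
  apply Subtype.ext
  simp only [comm, Submodule.coe_add]
  noncomm_ring

theorem comm_smul_right {d : ℕ} (t : ℂ) (x y : calL d) : comm x (t • y) = t • comm x y := by
  apply Subtype.ext
  simp only [comm, Submodule.coe_smul, mul_smul_comm, smul_mul_assoc, smul_sub]

theorem comm_jacobi {d : ℕ} (x y z : calL d) :
    comm x (comm y z) = comm (comm x y) z + comm y (comm x z) := by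
  apply Subtype.ext
  simp only [comm, Submodule.coe_add]
  noncomm_ring

/-- The linear map `π₁ + r π₂` from `𝓛` to itself. -/
def twist (d : ℕ) (r : ℂ) : calL d →ₗ[ℂ] calL d :=
  pi1 d + r • (pi2 d).smulRight (oneL d)

theorem twist_eq {d : ℕ} (r : ℂ) (x : calL d) :
    twist d r x = x + ((r - 1) * pi2 d x) • oneL d := by
  conv_rhs => rw [← pi1_add_pi2 x]
  simp only [twist, LinearMap.add_apply, LinearMap.smul_apply, LinearMap.smulRight_apply,
    map_add, map_smul, pi2_one]
  have h : pi2 d (pi1 d x) = 0 := pi2_of_mem (Submodule.coe_mem _)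
  rw [h]
  module

theorem comm_twist_left {d : ℕ} (r : ℂ) (x y : calL d) : comm (twist d r x) y = comm x y := by
  rw [twist_eq]
  apply Subtype.ext
  simp only [comm, oneL, Submodule.coe_add, Submodule.coe_smul, add_mul, mul_add, smul_mul_assoc,
    mul_smul_comm, one_mul, mul_one]
  abel

theorem comm_twist_right {d : ℕ} (r : ℂ) (x y : calL d) : comm x (twist d r y) = comm x y := by
  rw [twist_eq]
  apply Subtype.ext
  simp only [comm, oneL, Submodule.coe_add, Submodule.coe_smul, add_mul, mul_add, smul_mul_assoc,
    mul_smul_comm, one_mul, mul_one]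
  abel

/-- The Lie algebra `𝓛_r`: the space `𝓛` with the bracket
`[x, y]_r = π₁([x, y]) + r π₂([x, y])`. -/
def Lr (d : ℕ) (_r : ℂ) : Type := calL d

instance (d : ℕ) (r : ℂ) : AddCommGroup (Lr d r) := inferInstanceAs (AddCommGroup (calL d))

instance (d : ℕ) (r : ℂ) : Module ℂ (Lr d r) := inferInstanceAs (Module ℂ (calL d))

instance (d : ℕ) (r : ℂ) : Bracket (Lr d r) (Lr d r) where
  bracket x y := pi1 d (comm x y) + (r * pi2 d (comm x y)) • oneL d

theorem lie_eq_twist {d : ℕ} {r : ℂ} (x y : Lr d r) : ⁅x, y⁆ = twist d r (comm x y) := by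
  change pi1 d (comm x y) + (r * pi2 d (comm x y)) • oneL d = _
  rw [twist, LinearMap.add_apply, LinearMap.smul_apply, LinearMap.smulRight_apply, smul_smul]

instance (d : ℕ) (r : ℂ) : LieRing (Lr d r) where
  add_lie x y z := by
    simp only [lie_eq_twist]
    exact (congrArg (twist d r) (comm_add_left x y z)).trans (map_add (twist d r) _ _)
  lie_add x y z := by
    simp only [lie_eq_twist]
    exact (congrArg (twist d r) (comm_add_right x y z)).trans (map_add (twist d r) _ _)
  lie_self x := by
    rw [lie_eq_twist]
    exact (congrArg (twist d r) (comm_self x)).trans (map_zero (twist d r))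
  leibniz_lie x y z := by
    rw [lie_eq_twist x ⁅y, z⁆, lie_eq_twist ⁅x, y⁆ z, lie_eq_twist y ⁅x, z⁆, lie_eq_twist y z,
      lie_eq_twist x y, lie_eq_twist x z]
    have key : ∀ x y z : calL d, twist d r (comm x (twist d r (comm y z))) =
        twist d r (comm (twist d r (comm x y)) z) + twist d r (comm y (twist d r (comm x z))) := by
      intro x y z
      rw [comm_twist_right, comm_twist_right, comm_twist_left, ← map_add, comm_jacobi]
    exact key x y z

instance (d : ℕ) (r : ℂ) : LieAlgebra ℂ (Lr d r) where
  lie_smul t x y := by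
    simp only [lie_eq_twist]
    exact (congrArg (twist d r) (comm_smul_right t x y)).trans (map_smul (twist d r) t _)

/-- The element `v^{ij}(m, n)` of `𝓛_r`. -/
def vL {d : ℕ} (r : ℂ) (i j : Fin d) (m n : ℤ) : Lr d r := (⟨v i j m n, v_mem_calL i j m n⟩ : calL d)

/-! ## The subalgebra `𝓛_r⁺` and its one-dimensional module `ℂ 1` -/

/-- The subspace `Span 𝓑₊ ⊕ ℂ` of `𝓛`. -/
def calLPlus (d : ℕ) : Submodule ℂ (calL d) :=
  (Submodule.span ℂ (setBPlus d) ⊔ Submodule.span ℂ {1}).comap (calL d).subtype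

theorem setBPlus_subset (d : ℕ) : setBPlus d ⊆ setB d := by
  rintro x ⟨i, j, m, n, h, -, rfl⟩
  exact ⟨i, j, m, n, h, rfl⟩

theorem fockVal_zero_of_span_plus {d : ℕ} {x : Weyl d}
    (hx : x ∈ Submodule.span ℂ (setBPlus d)) : fockVal d 0 x = 0 := by
  induction hx using Submodule.span_induction with
  | mem x hx =>
    obtain ⟨i, j, m, n, h, h', rfl⟩ := hx
    rw [fockVal_v 0 h]
    rcases h' with h' | h' <;> simp [h']
  | zero => exact map_zero _
  | add x y _ _ hx hy => rw [map_add, hx, hy, add_zero]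
  | smul t x _ hx => rw [map_smul, hx, smul_zero]

theorem fockVal_of_mem_plus {d : ℕ} {x : calL d} (hx : x ∈ calLPlus d) :
    fockVal d 0 (x : Weyl d) = pi2 d x • 1 := by
  obtain ⟨x, hxL⟩ := x
  obtain ⟨y, hy, z, hz, e⟩ := Submodule.mem_sup.mp hx
  obtain ⟨s, rfl⟩ := Submodule.mem_span_singleton.mp hz
  have e' : y + s • (1 : Weyl d) = x := e
  subst e'
  have hyB : y ∈ Submodule.span ℂ (setB d) := Submodule.span_mono (setBPlus_subset d) hy
  have h1 : pi2 d ⟨y + s • 1, hxL⟩ = s := by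
    have : (⟨y + s • 1, hxL⟩ : calL d) = ⟨y, Submodule.mem_sup_left hyB⟩ + s • oneL d := rfl
    rw [this, map_add, map_smul, pi2_one, pi2_of_mem hyB, zero_add, smul_eq_mul, mul_one]
  rw [h1]
  change fockVal d 0 (y + s • 1) = _
  rw [map_add, map_smul, fockVal_one, fockVal_zero_of_span_plus hy, zero_add]

theorem mem_plus_of_fockVal {d : ℕ} {x : calL d} (hx : fockVal d 0 (x : Weyl d) = 0) :
    x ∈ calLPlus d ∧ pi2 d x = 0 := by
  have hp1 : ((pi1 d x : calL d) : Weyl d) ∈ Submodule.span ℂ (setB d) :=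
    Submodule.coe_mem (Submodule.projectionOnto _ _ (isCompl_spanB d) x)
  have e : ((pi1 d x : calL d) : Weyl d) + pi2 d x • (1 : Weyl d) = x :=
    congrArg Subtype.val (pi1_add_pi2 x)
  have h2 : pi2 d x = 0 := by
    have h := congrArg MvPolynomial.constantCoeff hx
    rw [← e, map_add, map_add, coeff_zero_fockVal 0 hp1, map_smul, fockVal_one,
      MvPolynomial.constantCoeff_smul, map_one, map_zero, smul_eq_mul, mul_one, zero_add] at h
    exact h
  refine ⟨?_, h2⟩
  rw [h2, zero_smul, add_zero] at e
  rw [e] at hp1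
  have hsub : setB d ⊆ setBPlus d ∪ {x | ∃ i j m n, Canon i j m n ∧ (m < 0 ∧ n < 0) ∧
      x = v i j m n} := by
    rintro x ⟨i, j, m, n, h, rfl⟩
    by_cases h' : 0 ≤ m ∨ 0 ≤ n
    · exact Or.inl ⟨i, j, m, n, h, h', rfl⟩
    · exact Or.inr ⟨i, j, m, n, h, by omega, rfl⟩
  have h3 := Submodule.span_mono (R := ℂ) hsub hp1
  rw [Submodule.span_union] at h3
  obtain ⟨y, hy, z, hz, hyz⟩ := Submodule.mem_sup.mp h3
  have hz1 : fockVal d 1 z = fockVal d 0 z ∧ z ∈ Submodule.span ℂ (setB d) := by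
    clear hyz
    induction hz using Submodule.span_induction with
    | mem z hz =>
      obtain ⟨i, j, m, n, h, ⟨h1, h2⟩, rfl⟩ := hz
      refine ⟨?_, Submodule.subset_span ⟨i, j, m, n, h, rfl⟩⟩
      rw [fockVal_v 1 h, fockVal_v 0 h]
      simp [not_le.mpr h1, not_le.mpr h2]
    | zero => exact ⟨by simp, Submodule.zero_mem _⟩
    | add x y _ _ hx hy => exact ⟨by rw [map_add, map_add, hx.1, hy.1], Submodule.add_mem _ hx.2 hy.2⟩
    | smul t x _ hx => exact ⟨by rw [map_smul, map_smul, hx.1], Submodule.smul_mem _ t hx.2⟩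
  have hz2 : fockVal d 1 z = 0 := by
    rw [hz1.1]
    rw [← hyz, map_add, fockVal_zero_of_span_plus hy, zero_add] at hx
    exact hx
  have hz3 : z = 0 := fockVal_injOn hz1.2 hz2
  rw [hz3, add_zero] at hyz
  change (x : Weyl d) ∈ Submodule.span ℂ (setBPlus d) ⊔ Submodule.span ℂ {1}
  rw [← hyz]
  exact Submodule.mem_sup_left hy

theorem comm_plus {d : ℕ} {x y : calL d} (hx : x ∈ calLPlus d) (hy : y ∈ calLPlus d) :
    comm x y ∈ calLPlus d ∧ pi2 d (comm x y) = 0 := by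
  apply mem_plus_of_fockVal
  have h1 := fockVal_of_mem_plus hx
  have h2 := fockVal_of_mem_plus hy
  rw [fockVal_apply] at h1 h2
  change fockVal d 0 ((x : Weyl d) * y - y * x) = 0
  rw [fockVal_apply, map_sub, map_mul, map_mul, LinearMap.sub_apply, Module.End.mul_apply,
    Module.End.mul_apply, h1, h2, map_smul, map_smul, h1, h2, smul_comm, sub_self]

theorem lie_plus {d : ℕ} {r : ℂ} {x y : Lr d r} (hx : (x : calL d) ∈ calLPlus d)
    (hy : (y : calL d) ∈ calLPlus d) :
    (⁅x, y⁆ : Lr d r) ∈ (calLPlus d : Submodule ℂ (calL d)) ∧ pi2 d (⁅x, y⁆ : Lr d r) = 0 := by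
  have h := comm_plus hx hy
  have e : (⁅x, y⁆ : Lr d r) = (comm (d := d) x y : calL d) := by
    rw [lie_eq_twist, twist_eq, h.2, mul_zero, zero_smul, add_zero]
  rw [e]
  exact h

/-- The Lie subalgebra `𝓛_r⁺ = Span 𝓑₊ ⊕ ℂ` of `𝓛_r`. -/
def LrPlus (d : ℕ) (r : ℂ) : LieSubalgebra ℂ (Lr d r) :=
  { (calLPlus d : Submodule ℂ (calL d)) with
    lie_mem' := fun {_ _} hx hy => (lie_plus hx hy).1 }

/-- The one-dimensional space `ℂ 1` underlying the `𝓛_r⁺`-module that is induced to `𝓛_r`. -/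
def Vac (_d : ℕ) (_r : ℂ) : Type := ℂ

instance (d : ℕ) (r : ℂ) : AddCommGroup (Vac d r) := inferInstanceAs (AddCommGroup ℂ)

instance (d : ℕ) (r : ℂ) : Module ℂ (Vac d r) := inferInstanceAs (Module ℂ ℂ)

/-- The scalar part `π₂` on `𝓛_r`. -/
def scalarPart (d : ℕ) (r : ℂ) : Lr d r →ₗ[ℂ] ℂ := pi2 d

/-- `𝓛_r⁺ = Span 𝓑₊ ⊕ ℂ` acts on `ℂ 1` through its scalar part: the elements of `𝓑₊` act as zero
and `s ∈ ℂ` acts as multiplication by `s`. -/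
instance (d : ℕ) (r : ℂ) : LieRingModule (LrPlus d r) (Vac d r) where
  bracket x z := scalarPart d r x • z
  add_lie x y z := by
    change scalarPart d r ((x : Lr d r) + y) • z = _
    rw [map_add, add_smul]
  lie_add x y z := smul_add _ _ _
  leibniz_lie x y z := by
    have h : scalarPart d r ⁅(x : Lr d r), (y : Lr d r)⁆ = 0 := (lie_plus x.2 y.2).2
    change scalarPart d r x • scalarPart d r y • z =
      scalarPart d r ⁅(x : Lr d r), (y : Lr d r)⁆ • z + scalarPart d r y • scalarPart d r x • z
    rw [h, zero_smul, zero_add, smul_comm]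

instance (d : ℕ) (r : ℂ) : LieModule ℂ (LrPlus d r) (Vac d r) where
  smul_lie t x z := by
    change scalarPart d r (t • (x : Lr d r)) • z = t • scalarPart d r x • z
    rw [map_smul, smul_assoc]
  lie_smul t x z := smul_comm _ _ _

/-! ## Induced modules and modules generated by a vector -/

section Induced

open scoped TensorProduct

/-- The action of `U(L)` on an `L`-module. -/
def envAct (L : Type*) [LieRing L] [LieAlgebra ℂ L] (N : Type*) [AddCommGroup N] [Module ℂ N]
    [LieRingModule L N] [LieModule ℂ L N] :
    UniversalEnvelopingAlgebra ℂ L →ₐ[ℂ] Module.End ℂ N :=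
  UniversalEnvelopingAlgebra.lift ℂ (LieModule.toEnd ℂ L N)

/-- The natural map `U(K) → U(L)` for a Lie subalgebra `K` of `L`. -/
def envIncl {L : Type*} [LieRing L] [LieAlgebra ℂ L] (K : LieSubalgebra ℂ L) :
    UniversalEnvelopingAlgebra ℂ K →ₐ[ℂ] UniversalEnvelopingAlgebra ℂ L :=
  UniversalEnvelopingAlgebra.lift ℂ ((UniversalEnvelopingAlgebra.ι ℂ).comp K.incl)

/-- The `U(L)`-submodule of `U(L) ⊗_ℂ N` generated by the elements `u a ⊗ n - u ⊗ a n` with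
`u ∈ U(L)`, `a ∈ U(K)`, `n ∈ N`. -/
def balancing {L : Type*} [LieRing L] [LieAlgebra ℂ L] (K : LieSubalgebra ℂ L)
    (N : Type*) [AddCommGroup N] [Module ℂ N] [LieRingModule K N] [LieModule ℂ K N] :
    Submodule (UniversalEnvelopingAlgebra ℂ L) (UniversalEnvelopingAlgebra ℂ L ⊗[ℂ] N) :=
  Submodule.span _ {t | ∃ (u : UniversalEnvelopingAlgebra ℂ L)
    (a : UniversalEnvelopingAlgebra ℂ K) (n : N),
    t = (u * envIncl K a) ⊗ₜ[ℂ] n - u ⊗ₜ[ℂ] (envAct K N a n)}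

/-- The induced module `U(L) ⊗_{U(K)} N`, for a module `N` over a Lie subalgebra `K` of `L`. The
tensor product over the noncommutative ring `U(K)` is the quotient of the one over `ℂ` by the
balancing relations. -/
def Induced {L : Type*} [LieRing L] [LieAlgebra ℂ L] (K : LieSubalgebra ℂ L)
    (N : Type*) [AddCommGroup N] [Module ℂ N] [LieRingModule K N] [LieModule ℂ K N] : Type _ :=
  (UniversalEnvelopingAlgebra ℂ L ⊗[ℂ] N) ⧸ balancing K N

instance {L : Type*} [LieRing L] [LieAlgebra ℂ L] (K : LieSubalgebra ℂ L)
    (N : Type*) [AddCommGroup N] [Module ℂ N] [LieRingModule K N] [LieModule ℂ K N] :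
    AddCommGroup (Induced K N) :=
  inferInstanceAs (AddCommGroup ((UniversalEnvelopingAlgebra ℂ L ⊗[ℂ] N) ⧸ balancing K N))

instance {L : Type*} [LieRing L] [LieAlgebra ℂ L] (K : LieSubalgebra ℂ L)
    (N : Type*) [AddCommGroup N] [Module ℂ N] [LieRingModule K N] [LieModule ℂ K N] :
    Module (UniversalEnvelopingAlgebra ℂ L) (Induced K N) :=
  inferInstanceAs (Module (UniversalEnvelopingAlgebra ℂ L)
    ((UniversalEnvelopingAlgebra ℂ L ⊗[ℂ] N) ⧸ balancing K N))

instance {L : Type*} [LieRing L] [LieAlgebra ℂ L] (K : LieSubalgebra ℂ L)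
    (N : Type*) [AddCommGroup N] [Module ℂ N] [LieRingModule K N] [LieModule ℂ K N] :
    Module ℂ (Induced K N) :=
  inferInstanceAs (Module ℂ ((UniversalEnvelopingAlgebra ℂ L ⊗[ℂ] N) ⧸ balancing K N))

instance {L : Type*} [LieRing L] [LieAlgebra ℂ L] (K : LieSubalgebra ℂ L)
    (N : Type*) [AddCommGroup N] [Module ℂ N] [LieRingModule K N] [LieModule ℂ K N] :
    IsScalarTower ℂ (UniversalEnvelopingAlgebra ℂ L) (Induced K N) :=
  inferInstanceAs (IsScalarTower ℂ (UniversalEnvelopingAlgebra ℂ L)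
    ((UniversalEnvelopingAlgebra ℂ L ⊗[ℂ] N) ⧸ balancing K N))

/-- `x ∈ L` acts on the induced module through its image in `U(L)`. -/
instance {L : Type*} [LieRing L] [LieAlgebra ℂ L] (K : LieSubalgebra ℂ L)
    (N : Type*) [AddCommGroup N] [Module ℂ N] [LieRingModule K N] [LieModule ℂ K N] :
    LieRingModule L (Induced K N) where
  bracket x w := UniversalEnvelopingAlgebra.ι ℂ x • w
  add_lie x y w := by
    change UniversalEnvelopingAlgebra.ι ℂ (x + y) • w = _
    rw [map_add, add_smul]
  lie_add x w w' := smul_add _ _ _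
  leibniz_lie x y w := by
    change UniversalEnvelopingAlgebra.ι ℂ x • UniversalEnvelopingAlgebra.ι ℂ y • w =
      UniversalEnvelopingAlgebra.ι ℂ ⁅x, y⁆ • w +
        UniversalEnvelopingAlgebra.ι ℂ y • UniversalEnvelopingAlgebra.ι ℂ x • w
    rw [LieHom.map_lie, LieRing.of_associative_ring_bracket, sub_smul, mul_smul, mul_smul,
      sub_add_cancel]

instance {L : Type*} [LieRing L] [LieAlgebra ℂ L] (K : LieSubalgebra ℂ L)
    (N : Type*) [AddCommGroup N] [Module ℂ N] [LieRingModule K N] [LieModule ℂ K N] :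
    LieModule ℂ L (Induced K N) where
  smul_lie t x w := by
    change UniversalEnvelopingAlgebra.ι ℂ (t • x) • w = t • UniversalEnvelopingAlgebra.ι ℂ x • w
    rw [map_smul, smul_assoc]
  lie_smul t x w := by
    change UniversalEnvelopingAlgebra.ι ℂ x • t • w = t • UniversalEnvelopingAlgebra.ι ℂ x • w
    rw [← algebraMap_smul (UniversalEnvelopingAlgebra ℂ L) t w, smul_smul,
      ← Algebra.commutes, mul_smul, algebraMap_smul]

/-- `U(L) w`, the submodule generated by a vector `w` of an `L`-module. -/
def envSpan (L : Type*) [LieRing L] [LieAlgebra ℂ L] {N : Type*} [AddCommGroup N] [Module ℂ N]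
    [LieRingModule L N] [LieModule ℂ L N] (w : N) : LieSubmodule ℂ L N :=
  { LinearMap.range (LinearMap.applyₗ w ∘ₗ (envAct L N).toLinearMap) with
    lie_mem := by
      rintro x _ ⟨u, rfl⟩
      refine ⟨UniversalEnvelopingAlgebra.ι ℂ x * u, ?_⟩
      change envAct L N (UniversalEnvelopingAlgebra.ι ℂ x * u) w = ⁅x, envAct L N u w⁆
      rw [map_mul, Module.End.mul_apply]
      rw [envAct, UniversalEnvelopingAlgebra.lift_ι_apply, LieModule.toEnd_apply_apply] }

end Induced

/-! ## The modules `M_r` and `M_r^{(1)}` -/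

/-- The induced `𝓛_r`-module `M_r = U(𝓛_r) ⊗_{U(𝓛_r⁺)} ℂ 1`. -/
abbrev Mr (d : ℕ) (r : ℂ) : Type := Induced (LrPlus d r) (Vac d r)

/-- The generator `1 ⊗ 1` of `M_r`. -/
def vacuum (d : ℕ) (r : ℂ) : Mr d r :=
  Submodule.Quotient.mk ((1 : UniversalEnvelopingAlgebra ℂ (Lr d r)) ⊗ₜ[ℂ] ((1 : ℂ) : Vac d r))

/-- The Lie subalgebra of `𝓛_r` generated by the `v^{ii}(m, n)` with `m ≤ n`, for a fixed `i`. -/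
def LrSub {d : ℕ} (r : ℂ) (i : Fin d) : LieSubalgebra ℂ (Lr d r) :=
  LieSubalgebra.lieSpan ℂ (Lr d r) {x | ∃ m n : ℤ, m ≤ n ∧ x = vL r i i m n}

/-- The Lie algebra `𝓛_r^{(1)}`, generated by the `v^{11}(m, n)` with `m ≤ n`. The index `1` of
the set `{1, …, d}` is the element `0` of `Fin d`. -/
def LrOne (d : ℕ) (hd : 2 ≤ d) (r : ℂ) : LieSubalgebra ℂ (Lr d r) :=
  LrSub r (⟨0, by omega⟩ : Fin d)

/-- The `𝓛_r^{(1)}`-submodule `M_r^{(1)} = U(𝓛_r^{(1)}) 1` of `M_r`. -/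
def MrOne (d : ℕ) (hd : 2 ≤ d) (r : ℂ) : LieSubmodule ℂ (LrOne d hd r) (Mr d r) :=
  envSpan (LrOne d hd r) (vacuum d r)

end

end AshiharaMiyamoto

namespace AshiharaMiyamoto

noncomputable section

attribute [local instance 100] LieRing.ofAssociativeRing

/-! ## Injections of the labels of the nonzero modes -/

/-! Neither `𝓛_r` nor `M_r` sees how the nonzero modes are arranged in `d` families. The nonzero
modes form countably many pairs `v^i(k + 1)`, `v^i(-k - 1)`, all alike up to rescaling, so any
injection `g` of the set of pairs into itself induces an endomorphism of the algebra `U(ĥ) / ⟨c -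
1⟩`. The zero modes are central there and act as zero on `M_r` (`zeroMode_lie`), so the endomorphism
may send them to zero.

This endomorphism preserves more than the commutation relations: it preserves the constant term
`vev` of every product `v_p v_q` (`vev_modeMap`), hence `π₂`, hence the bracket of `𝓛_r` for every
`r`. It also respects `𝓛_r⁺` and its character, so it induces a map `modeMr r g` on `M_r` that fixes
the vacuum and intertwines the actions along `modeLie r g`.

These maps are functorial in `g` (`modeMr_comp`, `modeMr_id`), and on a fixed vector they depend on
finitely many values of `g` only (`modeMr_local`). A finite piece of an injection extends to a
permutation, whose map is invertible, so every `modeMr r g` is injective (`modeMr_injective`).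

Now choose a fold: an injection of the pairs of all indices onto the pairs of index `1`. The image
of its map is exactly `M_r^{(1)}` (`IsFold.range_eq`), and up to nonzero scalars it matches the
operators `v_p v_q` without zero modes on `M_r` with those of index `1` on `M_r^{(1)}`; all other
`v_p v_q` act as zero. The lattices of submodules are therefore isomorphic (`IsFold.orderIso`), and
irreducibility is a property of the lattice. -/

/-- `(i, k)` labels the pair of modes `v^i(k + 1)`, `v^i(-k - 1)`. -/
abbrev Osc (d : ℕ) : Type := Fin d × ℕ

/-- The label of the pair of modes that contains a given nonzero mode. -/
def oscOf {d : ℕ} (p : Gen d) : Osc d := (p.1, p.2.natAbs - 1)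

/-- The map of mode labels that is induced by a map of oscillator labels. -/
def modeMap {d : ℕ} (g : Osc d → Osc d) (p : Gen d) : Gen d :=
  ((g (oscOf p)).1, p.2.sign * ((g (oscOf p)).2 + 1))

/-- The scaling that makes `v_p ↦ modeCoef g p • v_{modeMap g p}` compatible with the Heisenberg
relations; the zero modes are sent to zero. -/
def modeCoef {d : ℕ} (g : Osc d → Osc d) (p : Gen d) : ℂ :=
  if 0 < p.2 then (p.2 : ℂ) / ((modeMap g p).2 : ℂ) else if p.2 < 0 then 1 else 0

theorem modeMap_zero {d : ℕ} (g : Osc d → Osc d) (i : Fin d) : (modeMap g (i, 0)).2 = 0 := by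
  simp [modeMap]

theorem modeMap_pos {d : ℕ} (g : Osc d → Osc d) {p : Gen d} (h : 0 < p.2) :
    0 < (modeMap g p).2 := by
  simp only [modeMap, Int.sign_eq_one_of_pos h]
  omega

theorem modeMap_neg {d : ℕ} (g : Osc d → Osc d) {p : Gen d} (h : p.2 < 0) :
    (modeMap g p).2 < 0 := by
  simp only [modeMap, Int.sign_eq_neg_one_of_neg h]
  omega

theorem oscOf_modeMap {d : ℕ} (g : Osc d → Osc d) {p : Gen d} (h : p.2 ≠ 0) :
    oscOf (modeMap g p) = g (oscOf p) := by
  rcases lt_or_gt_of_ne h with h | h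
  · refine Prod.ext rfl ?_
    simp only [oscOf, modeMap, Int.sign_eq_neg_one_of_neg h]
    omega
  · refine Prod.ext rfl ?_
    simp only [oscOf, modeMap, Int.sign_eq_one_of_pos h]
    omega

theorem sign_modeMap {d : ℕ} (g : Osc d → Osc d) (p : Gen d) :
    (modeMap g p).2.sign = p.2.sign := by
  rcases lt_trichotomy p.2 0 with h | h | h
  · rw [Int.sign_eq_neg_one_of_neg h, Int.sign_eq_neg_one_of_neg (modeMap_neg g h)]
  · obtain ⟨i, m⟩ := p
    obtain rfl : m = 0 := h
    rw [modeMap_zero]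
  · rw [Int.sign_eq_one_of_pos h, Int.sign_eq_one_of_pos (modeMap_pos g h)]

/-- Zero modes have to be excluded: truncated subtraction in `oscOf` gives `(i, 0)` the label of
`v^i(±1)`, so the index of the image of a zero mode carries no meaning. -/
theorem modeMap_comp {d : ℕ} (g h : Osc d → Osc d) {p : Gen d} (hp : p.2 ≠ 0) :
    modeMap g (modeMap h p) = modeMap (g ∘ h) p := by
  conv_lhs => rw [modeMap]
  rw [oscOf_modeMap h hp, sign_modeMap]
  rfl

theorem modeMap_id {d : ℕ} {p : Gen d} (hp : p.2 ≠ 0) : modeMap id p = p := by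
  refine Prod.ext rfl ?_
  simp only [modeMap, id, oscOf]
  rcases lt_or_gt_of_ne hp with h | h
  · rw [Int.sign_eq_neg_one_of_neg h]
    omega
  · rw [Int.sign_eq_one_of_pos h]
    omega

theorem modeCoef_of_zero {d : ℕ} (g : Osc d → Osc d) {p : Gen d} (hp : p.2 = 0) :
    modeCoef g p = 0 := by
  simp [modeCoef, hp]

theorem modeCoef_ne_zero {d : ℕ} (g : Osc d → Osc d) {p : Gen d} (hp : p.2 ≠ 0) :
    modeCoef g p ≠ 0 := by
  rcases lt_or_gt_of_ne hp with h | h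
  · simp [modeCoef, h, h.not_gt]
  · rw [modeCoef, if_pos h]
    exact div_ne_zero (Int.cast_ne_zero.mpr hp) (Int.cast_ne_zero.mpr (modeMap_pos g h).ne')

theorem modeCoef_id {d : ℕ} {p : Gen d} (hp : p.2 ≠ 0) : modeCoef id p = 1 := by
  rcases lt_or_gt_of_ne hp with h | h
  · simp [modeCoef, h, h.not_gt]
  · rw [modeCoef, if_pos h, modeMap_id hp]
    exact div_self (Int.cast_ne_zero.mpr hp)

/-- For positive modes the quotients telescope; for the other modes all factors are `1` or `0`. -/
theorem modeCoef_comp {d : ℕ} (g h : Osc d → Osc d) (p : Gen d) :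
    modeCoef h p * modeCoef g (modeMap h p) = modeCoef (g ∘ h) p := by
  rcases lt_trichotomy p.2 0 with hp | hp | hp
  · simp [modeCoef, hp, hp.not_gt, modeMap_neg h hp, (modeMap_neg h hp).not_gt]
  · rw [modeCoef_of_zero _ hp, modeCoef_of_zero _ hp, zero_mul]
  · rw [modeCoef, modeCoef, modeCoef, if_pos hp, if_pos hp, if_pos (modeMap_pos h hp),
      modeMap_comp g h hp.ne']
    exact div_mul_div_cancel₀ (Int.cast_ne_zero.mpr (modeMap_pos h hp).ne')

/-- Two modes pair nontrivially iff they have the same oscillator label and opposite signs. -/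
theorem pairing_iff {d : ℕ} {p q : Gen d} (hp : p.2 ≠ 0) (hq : q.2 ≠ 0) :
    (p.2 + q.2 = 0 ∧ p.1 = q.1) ↔ oscOf p = oscOf q ∧ p.2.sign = -q.2.sign := by
  have h : p.2 + q.2 = 0 ↔ p.2.natAbs - 1 = q.2.natAbs - 1 ∧ p.2.sign = -q.2.sign := by
    have hs : ∀ n : ℤ, n ≠ 0 → (n < 0 ∧ n.sign = -1) ∨ (0 < n ∧ n.sign = 1) := fun n hn =>
      (lt_or_gt_of_ne hn).imp (fun h => ⟨h, Int.sign_eq_neg_one_of_neg h⟩)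
        fun h => ⟨h, Int.sign_eq_one_of_pos h⟩
    rcases hs _ hp with ⟨h, e⟩ | ⟨h, e⟩ <;> rcases hs _ hq with ⟨h', e'⟩ | ⟨h', e'⟩ <;>
      rw [e, e'] <;> omega
  simp only [oscOf, Prod.mk.injEq, h]
  tauto

/-- Pairing depends only on labels and signs. Signs are kept, and labels are moved by `g`, whose
injectivity prevents new coincidences. -/
theorem pairing_modeMap {d : ℕ} {g : Osc d → Osc d} (hg : Function.Injective g) {p q : Gen d}
    (hp : p.2 ≠ 0) (hq : q.2 ≠ 0) :
    ((modeMap g p).2 + (modeMap g q).2 = 0 ∧ (modeMap g p).1 = (modeMap g q).1) ↔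
      (p.2 + q.2 = 0 ∧ p.1 = q.1) := by
  have h : ∀ {p : Gen d}, p.2 ≠ 0 → (modeMap g p).2 ≠ 0 := fun {p} hp => by
    rcases lt_or_gt_of_ne hp with h | h
    · exact (modeMap_neg g h).ne
    · exact (modeMap_pos g h).ne'
  rw [pairing_iff (h hp) (h hq), pairing_iff hp hq, sign_modeMap, sign_modeMap,
    oscOf_modeMap g hp, oscOf_modeMap g hq, hg.eq_iff]

/-- The image pair has its own mode number as commutator. The whole correction is placed on the
positive mode, so negative modes need no rescaling. -/
theorem modeCoef_mul_pos {d : ℕ} (g : Osc d → Osc d) {p q : Gen d} (hp : 0 < p.2)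
    (hpq : p.2 + q.2 = 0) :
    modeCoef g p * modeCoef g q * ((modeMap g p).2 : ℂ) = p.2 := by
  have hq : q.2 < 0 := by omega
  rw [modeCoef, modeCoef, if_pos hp, if_neg hq.not_gt, if_pos hq, mul_one]
  exact div_mul_cancel₀ _ (Int.cast_ne_zero.mpr (modeMap_pos g hp).ne')

/-! ### Constant terms of products of two modes -/

/-- The coefficient of `1` in `v_p v_q`. -/
def vev {d : ℕ} (p q : Gen d) : ℂ :=
  if (p.2 + q.2 = 0 ∧ p.1 = q.1) ∧ 0 < p.2 then (p.2 : ℂ) else 0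

/-- Zero modes never contribute a constant, so killing them is harmless; the other modes keep their
pairings and signs. Invariance of `form` alone would not suffice, since the bracket of `𝓛_r`
involves `π₂`. -/
theorem vev_modeMap {d : ℕ} {g : Osc d → Osc d} (hg : Function.Injective g) (p q : Gen d) :
    modeCoef g p * modeCoef g q * vev (modeMap g p) (modeMap g q) = vev p q := by
  by_cases hp : p.2 = 0
  · rw [modeCoef_of_zero g hp, zero_mul, zero_mul, vev, if_neg (fun h => by omega)]
  by_cases hq : q.2 = 0
  · rw [modeCoef_of_zero g hq, mul_zero, zero_mul, vev, if_neg (fun h => by omega)]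
  simp only [vev, pairing_modeMap hg hp hq]
  rcases lt_or_gt_of_ne hp with h | h
  · simp [h.not_gt, (modeMap_neg g h).not_gt]
  · simp only [h, modeMap_pos g h, and_true]
    split_ifs with h'
    · exact modeCoef_mul_pos g h h'.1
    · exact mul_zero _

theorem form_eq_vev {d : ℕ} (p q : Gen d) :
    form d (Finsupp.single p 1) (Finsupp.single q 1) = vev p q - vev q p := by
  rw [form_single, vev, vev]
  by_cases h : p.2 + q.2 = 0 ∧ p.1 = q.1
  · have h' : q.2 + p.2 = 0 ∧ q.1 = p.1 := ⟨by omega, h.2.symm⟩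
    have hq : (q.2 : ℂ) = -p.2 := by
      rw [← Int.cast_neg]
      congr 1
      omega
    rw [if_pos h, hq]
    rcases lt_trichotomy p.2 0 with h0 | h0 | h0
    · rw [if_neg (fun h1 => h0.not_gt h1.2), if_pos ⟨h', by omega⟩]
      ring
    · rw [if_neg (fun h1 => h0.not_gt h1.2), if_neg (fun h1 => by omega), h0]
      simp
    · rw [if_pos ⟨h, h0⟩, if_neg (fun h1 => by omega)]
      ring
  · rw [if_neg h, if_neg (fun h' => h h'.1),
      if_neg (fun h' => h ⟨by omega, h'.1.2.symm⟩), sub_zero]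

theorem form_modeMap {d : ℕ} {g : Osc d → Osc d} (hg : Function.Injective g) (p q : Gen d) :
    modeCoef g p * modeCoef g q *
      form d (Finsupp.single (modeMap g p) 1) (Finsupp.single (modeMap g q) 1) =
      form d (Finsupp.single p 1) (Finsupp.single q 1) := by
  rw [form_eq_vev, form_eq_vev, ← vev_modeMap hg p q, ← vev_modeMap hg q p]
  ring

/-! ## The induced endomorphisms of `U(ĥ) / ⟨c - 1⟩` -/

/-- The linear map `v_p ↦ modeCoef g p • v_{modeMap g p}`. -/
def modeLin {d : ℕ} (g : Osc d → Osc d) : (Gen d →₀ ℂ) →ₗ[ℂ] (Gen d →₀ ℂ) :=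
  Finsupp.linearCombination ℂ fun p => modeCoef g p • Finsupp.single (modeMap g p) 1

theorem form_modeLin {d : ℕ} {g : Osc d → Osc d} (hg : Function.Injective g)
    (x y : Gen d →₀ ℂ) : form d (modeLin g x) (modeLin g y) = form d x y := by
  have h : (form d).compl₁₂ (modeLin g) (modeLin g) = form d := by
    refine Finsupp.lhom_ext' fun p => LinearMap.ext_ring ?_
    refine Finsupp.lhom_ext' fun q => LinearMap.ext_ring ?_
    simp only [LinearMap.coe_comp, Function.comp_apply, Finsupp.lsingle_apply,
      LinearMap.compl₁₂_apply, modeLin, Finsupp.linearCombination_single, one_smul, map_smul,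
      LinearMap.smul_apply, smul_eq_mul]
    rw [← form_modeMap hg p q]
    ring
  exact congrArg (fun B => B x y) h

/-- The endomorphism of the Heisenberg Lie algebra induced by an injection of labels. -/
def modeHeis {d : ℕ} (g : Osc d ↪ Osc d) : Heis d →ₗ⁅ℂ⁆ Heis d where
  toFun x := (modeLin g x.1, x.2)
  map_add' x y := Prod.ext (map_add (modeLin g) x.1 y.1) rfl
  map_smul' t x := Prod.ext (map_smul (modeLin g) t x.1) rfl
  map_lie' := fun {x y} => Prod.ext (map_zero (modeLin g)) (form_modeLin g.injective x.1 y.1).symm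

/-- `toWeyl` as a homomorphism of Lie algebras. -/
def toWeylLie (d : ℕ) : Heis d →ₗ⁅ℂ⁆ Weyl d :=
  { toWeyl d with map_lie' := fun {x y} => toWeyl_lie x y }

/-- The endomorphism of `U(ĥ) / ⟨c - 1⟩` induced by an injection of labels. -/
def modeWeyl {d : ℕ} (g : Osc d ↪ Osc d) : Weyl d →ₐ[ℂ] Weyl d :=
  RingQuot.liftAlgHom ℂ ⟨UniversalEnvelopingAlgebra.lift ℂ ((toWeylLie d).comp (modeHeis g)), by
    rintro a b ⟨rfl, rfl⟩
    rw [UniversalEnvelopingAlgebra.lift_ι_apply, map_one]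
    refine Eq.trans ?_ (toWeyl_heisC d)
    exact congrArg (toWeyl d) (Prod.ext (map_zero (modeLin g)) rfl)⟩

/-- `v_p v_q` for mode labels `p`, `q`. -/
def vv {d : ℕ} (p q : Gen d) : Weyl d := v p.1 q.1 p.2 q.2

theorem modeWeyl_wV {d : ℕ} (g : Osc d ↪ Osc d) (p : Gen d) :
    modeWeyl g (wV p.1 p.2) = modeCoef g p • wV (modeMap g p).1 (modeMap g p).2 := by
  have h : modeWeyl g (wV p.1 p.2) = toWeyl d (modeHeis g (heisV p.1 p.2)) := by
    rw [wV, toWeyl, modeWeyl, LinearMap.comp_apply, AlgHom.toLinearMap_apply,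
      RingQuot.liftAlgHom_mkAlgHom_apply, LieHom.coe_toLinearMap,
      UniversalEnvelopingAlgebra.lift_ι_apply]
    rfl
  rw [h, wV, ← map_smul]
  refine congrArg (toWeyl d) (Prod.ext ?_ (mul_zero _).symm)
  change modeLin g (Finsupp.single p 1) = modeCoef g p • Finsupp.single (modeMap g p) 1
  rw [modeLin, Finsupp.linearCombination_single, one_smul]

theorem modeWeyl_vv {d : ℕ} (g : Osc d ↪ Osc d) (p q : Gen d) :
    modeWeyl g (vv p q) = (modeCoef g p * modeCoef g q) • vv (modeMap g p) (modeMap g q) := by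
  rw [vv, v, map_mul, modeWeyl_wV, modeWeyl_wV, smul_mul_smul_comm]
  rfl

/-! ## The induced endomorphisms of `𝓛_r` -/

theorem vv_comm {d : ℕ} (p q : Gen d) : vv p q = vv q p + (vev p q - vev q p) • (1 : Weyl d) := by
  rw [← form_eq_vev, form_single, ← wV_comm, vv, vv, v, v]
  abel

/-- The order that defines `𝓑` is a normal order: for equal indices `m ≤ n`, so `m + n = 0` excludes
`m > 0`. -/
theorem vev_of_canon {d : ℕ} {p q : Gen d} (h : Canon p.1 q.1 p.2 q.2) : vev p q = 0 := by
  rw [vev, if_neg]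
  rintro ⟨⟨h1, h2⟩, h3⟩
  rcases h with h | h
  · exact h.ne h2
  · omega

theorem canon_or {d : ℕ} (p q : Gen d) : Canon p.1 q.1 p.2 q.2 ∨ Canon q.1 p.1 q.2 p.2 := by
  unfold Canon
  rcases lt_trichotomy p.1 q.1 with h | h | h
  · exact Or.inl (Or.inl h)
  · rcases le_total p.2 q.2 with h' | h'
    · exact Or.inl (Or.inr ⟨h, h'⟩)
    · exact Or.inr (Or.inr ⟨h.symm, h'⟩)
  · exact Or.inr (Or.inl h)

/-- `v_p v_q` as an element of `𝓛`. -/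
def vvL {d : ℕ} (p q : Gen d) : calL d := ⟨vv p q, v_mem_calL _ _ _ _⟩

theorem vvL_comm {d : ℕ} (p q : Gen d) : vvL p q = vvL q p + (vev p q - vev q p) • oneL d :=
  Subtype.ext (vv_comm p q)

/-- One of the two orders of the factors lies in `𝓑`, where `π₂` vanishes; the other order differs
from it by the commutator. -/
theorem pi2_vvL {d : ℕ} (p q : Gen d) : pi2 d (vvL p q) = vev p q := by
  have key : ∀ {p q : Gen d}, Canon p.1 q.1 p.2 q.2 → pi2 d (vvL p q) = 0 := fun {p q} h =>
    pi2_of_mem (Submodule.subset_span ⟨p.1, q.1, p.2, q.2, h, rfl⟩)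
  rcases canon_or p q with h | h
  · rw [key h, vev_of_canon h]
  · rw [vvL_comm, map_add, key h, map_smul, pi2_one, vev_of_canon h]
    simp

/-- An induction principle for the elements of `𝓛`. -/
theorem calL_induction {d : ℕ} {W : Submodule ℂ (calL d)} (hv : ∀ p q, vvL p q ∈ W)
    (h1 : oneL d ∈ W) (x : calL d) : x ∈ W := by
  have h : calL d ≤ W.map (calL d).subtype := by
    conv_lhs => rw [calL_eq_span]
    rw [Submodule.span_le]
    rintro x (⟨i, j, m, n, rfl⟩ | rfl)
    · exact ⟨_, hv (i, m) (j, n), rfl⟩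
    · exact ⟨_, h1, rfl⟩
  obtain ⟨y, hy, e⟩ := h x.2
  rwa [← Subtype.ext e]

theorem modeWeyl_mem {d : ℕ} (g : Osc d ↪ Osc d) {x : Weyl d} (hx : x ∈ calL d) :
    modeWeyl g x ∈ calL d := by
  have h := calL_induction (W := ((calL d).comap (modeWeyl g).toLinearMap).comap (calL d).subtype)
    (fun p q => ?_) ?_ ⟨x, hx⟩
  · exact h
  · change modeWeyl g (vv p q) ∈ calL d
    rw [modeWeyl_vv]
    exact (calL d).smul_mem _ (v_mem_calL _ _ _ _)
  · change modeWeyl g 1 ∈ calL d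
    rw [map_one]
    exact one_mem_calL d

/-- The restriction of `modeWeyl g` to `𝓛`. -/
def modeL {d : ℕ} (g : Osc d ↪ Osc d) : calL d →ₗ[ℂ] calL d :=
  (modeWeyl g).toLinearMap.restrict fun _ hx => modeWeyl_mem g hx

theorem modeL_vvL {d : ℕ} (g : Osc d ↪ Osc d) (p q : Gen d) :
    modeL g (vvL p q) = (modeCoef g p * modeCoef g q) • vvL (modeMap g p) (modeMap g q) :=
  Subtype.ext (modeWeyl_vv g p q)

theorem modeL_one {d : ℕ} (g : Osc d ↪ Osc d) : modeL g (oneL d) = oneL d :=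
  Subtype.ext (map_one (modeWeyl g))

theorem pi2_modeL {d : ℕ} (g : Osc d ↪ Osc d) (x : calL d) : pi2 d (modeL g x) = pi2 d x := by
  have h := calL_induction (W := LinearMap.eqLocus (pi2 d ∘ₗ modeL g) (pi2 d))
    (fun p q => ?_) ?_ x
  · exact h
  · change pi2 d (modeL g (vvL p q)) = pi2 d (vvL p q)
    rw [modeL_vvL, map_smul, pi2_vvL, pi2_vvL, smul_eq_mul, vev_modeMap g.injective]
  · change pi2 d (modeL g (oneL d)) = pi2 d (oneL d)
    rw [modeL_one]

theorem modeL_comm {d : ℕ} (g : Osc d ↪ Osc d) (x y : calL d) :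
    modeL g (comm x y) = comm (modeL g x) (modeL g y) := by
  refine Subtype.ext ?_
  change modeWeyl g ((x : Weyl d) * y - y * x) = _
  rw [map_sub, map_mul, map_mul]
  rfl

/-- The twist is the identity plus `(r - 1) π₂` times `1`, and both `π₂` and `1` are preserved. This
is why the value of `r` plays no role. -/
theorem modeL_twist {d : ℕ} (g : Osc d ↪ Osc d) (r : ℂ) (x : calL d) :
    modeL g (twist d r x) = twist d r (modeL g x) := by
  rw [twist_eq, twist_eq, map_add, map_smul, modeL_one, pi2_modeL]

/-- The endomorphism of `𝓛_r` induced by an injection of labels. -/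
def modeLie {d : ℕ} (r : ℂ) (g : Osc d ↪ Osc d) : Lr d r →ₗ⁅ℂ⁆ Lr d r :=
  { (modeL g : calL d →ₗ[ℂ] calL d) with
    map_lie' := fun {x y} => by
      have h := (modeL_twist g r (comm x y)).trans (congrArg (twist d r) (modeL_comm g x y))
      exact (congrArg (modeL g) (lie_eq_twist x y)).trans (h.trans (lie_eq_twist _ _).symm) }

/-! ## The module `M_r` -/

/-- `v_p v_q` as an element of `𝓛_r`. -/
abbrev vvr {d : ℕ} (r : ℂ) (p q : Gen d) : Lr d r := vL r p.1 q.1 p.2 q.2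

/-- The element `1` of `𝓛_r`. -/
def oneR (d : ℕ) (r : ℂ) : Lr d r := oneL d

theorem Lr_induction {d : ℕ} {r : ℂ} {W : Submodule ℂ (Lr d r)} (hv : ∀ p q, vvr r p q ∈ W)
    (h1 : oneR d r ∈ W) (x : Lr d r) : x ∈ W :=
  calL_induction (W := W) hv h1 x

theorem vvr_comm {d : ℕ} (r : ℂ) (p q : Gen d) :
    vvr r p q = vvr r q p + (vev p q - vev q p) • oneR d r :=
  vvL_comm p q

theorem modeLie_vvr {d : ℕ} (r : ℂ) (g : Osc d ↪ Osc d) (p q : Gen d) :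
    modeLie r g (vvr r p q) =
      (modeCoef g p * modeCoef g q) • vvr r (modeMap g p) (modeMap g q) :=
  modeL_vvL g p q

theorem modeLie_one {d : ℕ} (r : ℂ) (g : Osc d ↪ Osc d) : modeLie r g (oneR d r) = oneR d r :=
  modeL_one g

theorem scalarPart_modeLie {d : ℕ} (r : ℂ) (g : Osc d ↪ Osc d) (x : Lr d r) :
    scalarPart d r (modeLie r g x) = scalarPart d r x :=
  pi2_modeL g x

theorem scalarPart_one (d : ℕ) (r : ℂ) : scalarPart d r (oneR d r) = 1 := pi2_one d

theorem oneR_mem_plus (d : ℕ) (r : ℂ) : oneR d r ∈ LrPlus d r :=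
  Submodule.mem_sup_right (Submodule.mem_span_singleton_self 1)

theorem vvr_mem_plus {d : ℕ} (r : ℂ) {p q : Gen d} (h : 0 ≤ p.2 ∨ 0 ≤ q.2) :
    vvr r p q ∈ LrPlus d r := by
  have key : ∀ {p q : Gen d}, Canon p.1 q.1 p.2 q.2 → 0 ≤ p.2 ∨ 0 ≤ q.2 →
      vvr r p q ∈ LrPlus d r := fun {p q} h h' =>
    Submodule.mem_sup_left (Submodule.subset_span ⟨p.1, q.1, p.2, q.2, h, h', rfl⟩)
  rcases canon_or p q with h' | h'
  · exact key h' h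
  · rw [vvr_comm]
    exact add_mem (key h' h.symm) (SMulMemClass.smul_mem _ (oneR_mem_plus d r))

theorem LrPlus_le {d : ℕ} {r : ℂ} {W : Submodule ℂ (Lr d r)}
    (hv : ∀ p q : Gen d, 0 ≤ p.2 ∨ 0 ≤ q.2 → vvr r p q ∈ W) (h1 : oneR d r ∈ W) {x : Lr d r}
    (hx : x ∈ LrPlus d r) : x ∈ W := by
  have h : Submodule.span ℂ (setBPlus d) ⊔ Submodule.span ℂ {1} ≤
      Submodule.map (calL d).subtype (W : Submodule ℂ (calL d)) := by
    rw [sup_le_iff, Submodule.span_le, Submodule.span_le]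
    constructor
    · rintro x ⟨i, j, m, n, -, h, rfl⟩
      exact ⟨_, hv (i, m) (j, n) h, rfl⟩
    · rintro x rfl
      exact ⟨_, h1, rfl⟩
  obtain ⟨y, hy, e⟩ := h hx
  rwa [← Subtype.ext e]

theorem modeLie_mem_plus {d : ℕ} {r : ℂ} (g : Osc d ↪ Osc d) {x : Lr d r}
    (hx : x ∈ LrPlus d r) : modeLie r g x ∈ LrPlus d r := by
  refine LrPlus_le (W := (LrPlus d r).toSubmodule.comap (modeLie r g).toLinearMap)
    (fun p q h => ?_) ?_ hx
  · change modeLie r g (vvr r p q) ∈ LrPlus d r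
    rw [modeLie_vvr]
    refine SMulMemClass.smul_mem _ (vvr_mem_plus r (h.imp ?_ ?_)) <;>
    · intro h
      rw [← Int.sign_nonneg_iff] at h ⊢
      rwa [sign_modeMap]
  · change modeLie r g (oneR d r) ∈ LrPlus d r
    rw [modeLie_one]
    exact oneR_mem_plus d r

/-! ### Generation of enveloping algebras -/

section Enveloping

variable {L : Type*} [LieRing L] [LieAlgebra ℂ L]

/-- The canonical map of `L` corestricts to `S`. Its lift followed by the inclusion of `S` agrees
with the identity on `L`, hence everywhere by the universal property. -/
theorem env_adjoin (S : Subalgebra ℂ (UniversalEnvelopingAlgebra ℂ L))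
    (h : ∀ x : L, UniversalEnvelopingAlgebra.ι ℂ x ∈ S) (u : UniversalEnvelopingAlgebra ℂ L) :
    u ∈ S := by
  let f : L →ₗ⁅ℂ⁆ S :=
    { toFun := fun x => ⟨UniversalEnvelopingAlgebra.ι ℂ x, h x⟩
      map_add' := fun x y => Subtype.ext (map_add _ x y)
      map_smul' := fun t x => Subtype.ext (map_smul _ t x)
      map_lie' := fun {x y} => Subtype.ext (LieHom.map_lie _ x y) }
  have e : S.val.comp (UniversalEnvelopingAlgebra.lift ℂ f) = AlgHom.id ℂ _ := by
    refine UniversalEnvelopingAlgebra.hom_ext _ (LieHom.ext fun x => ?_)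
    change ((UniversalEnvelopingAlgebra.lift ℂ f (UniversalEnvelopingAlgebra.ι ℂ x) : S) :
      UniversalEnvelopingAlgebra ℂ L) = UniversalEnvelopingAlgebra.ι ℂ x
    rw [UniversalEnvelopingAlgebra.lift_ι_apply]
    rfl
  rw [← AlgHom.id_apply (R := ℂ) u, ← e]
  exact Subtype.coe_prop _

/-- A subspace stable under the image of a Lie algebra is stable under the enveloping algebra. -/
theorem env_stable {N : Type*} [AddCommGroup N] [Module ℂ N]
    (ρ : UniversalEnvelopingAlgebra ℂ L →ₐ[ℂ] Module.End ℂ N) (W : Submodule ℂ N)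
    (h : ∀ (x : L), ∀ w ∈ W, ρ (UniversalEnvelopingAlgebra.ι ℂ x) w ∈ W)
    (u : UniversalEnvelopingAlgebra ℂ L) : ∀ w ∈ W, ρ u w ∈ W := by
  let S : Subalgebra ℂ (UniversalEnvelopingAlgebra ℂ L) :=
    { carrier := {u | ∀ w ∈ W, ρ u w ∈ W}
      mul_mem' := fun {a b} ha hb w hw => by
        rw [map_mul, Module.End.mul_apply]
        exact ha _ (hb _ hw)
      add_mem' := fun {a b} ha hb w hw => by
        rw [map_add, LinearMap.add_apply]
        exact add_mem (ha _ hw) (hb _ hw)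
      algebraMap_mem' := fun t w hw => by
        rw [AlgHom.commutes, Module.algebraMap_end_apply]
        exact W.smul_mem t hw }
  exact env_adjoin S h u

theorem envAct_ι {N : Type*} [AddCommGroup N] [Module ℂ N] [LieRingModule L N]
    [LieModule ℂ L N] (x : L) (n : N) :
    envAct L N (UniversalEnvelopingAlgebra.ι ℂ x) n = ⁅x, n⁆ := by
  rw [envAct, UniversalEnvelopingAlgebra.lift_ι_apply, LieModule.toEnd_apply_apply]

end Enveloping

/-! ### The vacuum, the unit and the zero modes -/

/-- The generator of the one-dimensional module `ℂ 1`. -/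
def vacGen (d : ℕ) (r : ℂ) : Vac d r := (1 : ℂ)

open scoped TensorProduct in
/-- A subspace of `M_r` which contains the vacuum and is stable under `𝓛_r` is everything. -/
theorem Mr_top_of_lie {d : ℕ} {r : ℂ} {W : Submodule ℂ (Mr d r)} (h0 : vacuum d r ∈ W)
    (h : ∀ (x : Lr d r), ∀ w ∈ W, ⁅x, w⁆ ∈ W) (m : Mr d r) : m ∈ W := by
  have hu : ∀ u : UniversalEnvelopingAlgebra ℂ (Lr d r), u • vacuum d r ∈ W := fun u =>
    env_stable (Algebra.lsmul ℂ ℂ (Mr d r)) W h u _ h0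
  obtain ⟨t, rfl⟩ := Submodule.Quotient.mk_surjective _ m
  induction t with
  | zero => exact W.zero_mem
  | add x y hx hy => exact W.add_mem hx hy
  | tmul u z =>
    obtain ⟨c, rfl⟩ : ∃ c : ℂ, c • vacGen d r = z := ⟨z, mul_one (M := ℂ) z⟩
    have e : u ⊗ₜ[ℂ] (c • vacGen d r) = c • u • ((1 : UniversalEnvelopingAlgebra ℂ (Lr d r)) ⊗ₜ[ℂ]
        vacGen d r) := by
      rw [TensorProduct.smul_tmul', smul_eq_mul, mul_one, TensorProduct.tmul_smul]
    rw [e]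
    exact W.smul_mem c (hu u)

-- This is the balancing relation for `u = 1` and an element of degree one in `U(𝓛_r⁺)`.
open scoped TensorProduct in
theorem lie_vacuum {d : ℕ} {r : ℂ} {x : Lr d r} (hx : x ∈ LrPlus d r) :
    ⁅x, vacuum d r⁆ = scalarPart d r x • vacuum d r := by
  have h : (((1 : UniversalEnvelopingAlgebra ℂ (Lr d r)) *
        envIncl (LrPlus d r) (UniversalEnvelopingAlgebra.ι ℂ ⟨x, hx⟩)) ⊗ₜ[ℂ] vacGen d r -
      1 ⊗ₜ[ℂ] (envAct (LrPlus d r) (Vac d r) (UniversalEnvelopingAlgebra.ι ℂ ⟨x, hx⟩) (vacGen d r))) ∈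
      balancing (LrPlus d r) (Vac d r) := Submodule.subset_span ⟨1, _, _, rfl⟩
  have h' := (Submodule.Quotient.eq _).mpr h
  rw [envAct_ι, envIncl, UniversalEnvelopingAlgebra.lift_ι_apply, one_mul] at h'
  refine Eq.trans ?_ (h'.trans ?_)
  · change Submodule.Quotient.mk (UniversalEnvelopingAlgebra.ι ℂ x •
      ((1 : UniversalEnvelopingAlgebra ℂ (Lr d r)) ⊗ₜ[ℂ] vacGen d r)) = _
    rw [TensorProduct.smul_tmul', smul_eq_mul, mul_one]
    rfl
  · change Submodule.Quotient.mk ((1 : UniversalEnvelopingAlgebra ℂ (Lr d r)) ⊗ₜ[ℂ]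
      (scalarPart d r x • vacGen d r)) = _
    rw [TensorProduct.tmul_smul]
    rfl

/-- The element `1` is central in `𝓛_r` and fixes the vacuum, so the vectors it fixes form a
submodule containing the generator. -/
theorem one_lie {d : ℕ} {r : ℂ} (m : Mr d r) : ⁅oneR d r, m⁆ = m := by
  have hc : ∀ x : Lr d r, ⁅oneR d r, x⁆ = 0 := fun x => by
    rw [lie_eq_twist]
    have h : comm (oneL d) (x : calL d) = 0 := Subtype.ext (by simp [comm, oneL])
    exact (congrArg (twist d r) h).trans (map_zero (twist d r))
  refine Mr_top_of_lie (W := LinearMap.eqLocus (LieModule.toEnd ℂ (Lr d r) (Mr d r) (oneR d r))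
    LinearMap.id) ?_ (fun x w hw => ?_) m
  · change ⁅oneR d r, vacuum d r⁆ = vacuum d r
    rw [lie_vacuum (oneR_mem_plus d r), scalarPart_one, one_smul]
  · change ⁅oneR d r, ⁅x, w⁆⁆ = ⁅x, w⁆
    replace hw : ⁅oneR d r, w⁆ = w := hw
    rw [leibniz_lie, hc, zero_lie, zero_add, hw]

theorem lie_mem_of_vvr {d : ℕ} {r : ℂ} {W : Submodule ℂ (Mr d r)} {m : Mr d r}
    (hm : m ∈ W) (h : ∀ p q : Gen d, ⁅vvr r p q, m⁆ ∈ W) (x : Lr d r) : ⁅x, m⁆ ∈ W := by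
  refine Lr_induction (W := W.comap ((LieModule.toEnd ℂ (Lr d r) (Mr d r)).toLinearMap.flip m))
    h ?_ x
  change ⁅oneR d r, m⁆ ∈ W
  rwa [one_lie]

/-- The zero modes act as zero on `M_r`. -/
theorem zeroMode_lie {d : ℕ} {r : ℂ} {p q : Gen d} (h : p.2 = 0 ∨ q.2 = 0) (m : Mr d r) :
    ⁅vvr r p q, m⁆ = 0 := by
  have hvev : ∀ {p q : Gen d}, p.2 = 0 ∨ q.2 = 0 → vev p q = 0 := fun {p q} h => by
    rw [vev, if_neg]
    omega
  have hform : ∀ {p q : Gen d}, p.2 = 0 →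
      wV p.1 p.2 * wV q.1 q.2 = wV q.1 q.2 * wV p.1 p.2 := fun {p q} h => by
    rw [← sub_eq_zero, wV_comm]
    simp [h]
  -- The common kernel of all `v_p v_q` with `p` a zero mode contains the vacuum. It remains to see
  -- that it is a submodule.
  have key : ∀ m : Mr d r, m ∈ (⨅ (p : Gen d) (q : Gen d) (_ : p.2 = 0),
      LinearMap.ker (LieModule.toEnd ℂ (Lr d r) (Mr d r) (vvr r p q)) : Submodule ℂ (Mr d r)) := by
    refine Mr_top_of_lie ?_ (fun x w hw => ?_)
    · simp only [Submodule.mem_iInf, LinearMap.mem_ker, LieModule.toEnd_apply_apply]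
      intro p q hp
      rw [lie_vacuum (vvr_mem_plus r (Or.inl hp.ge))]
      have e : scalarPart d r (vvr r p q) = vev p q := pi2_vvL p q
      rw [e, hvev (Or.inl hp), zero_smul]
    · simp only [Submodule.mem_iInf, LinearMap.mem_ker, LieModule.toEnd_apply_apply] at hw ⊢
      intro p q hp
      rw [leibniz_lie, hw p q hp, lie_zero, add_zero]
      -- Since `v_p` is central in the Heisenberg algebra, it factors out of the commutator, and the
      -- bracket again consists of products with first factor `v_p`.
      have hbr : ∀ p q s t : Gen d, p.2 = 0 → ⁅vvr r p q, vvr r s t⁆ =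
          form d (Finsupp.single q 1) (Finsupp.single s 1) • vvr r p t +
          form d (Finsupp.single q 1) (Finsupp.single t 1) • vvr r p s := by
        intro p q s t hp
        have e : comm (vvL p q) (vvL s t) =
            form d (Finsupp.single q 1) (Finsupp.single s 1) • vvL p t +
            form d (Finsupp.single q 1) (Finsupp.single t 1) • vvL p s := by
          refine Subtype.ext ?_
          change vv p q * vv s t - vv s t * vv p q = form d (Finsupp.single q 1)
            (Finsupp.single s 1) • vv p t + form d (Finsupp.single q 1)
            (Finsupp.single t 1) • vv p s
          have h1 := wV_comm q.1 s.1 q.2 s.2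
          have h2 := wV_comm q.1 t.1 q.2 t.2
          rw [← form_single q s] at h1
          rw [← form_single q t] at h2
          have e1 := congrArg (fun z => wV p.1 p.2 * z * wV t.1 t.2) h1
          have e2 := congrArg (fun z => wV p.1 p.2 * wV s.1 s.2 * z) h2
          simp only [mul_smul_comm, smul_mul_assoc, mul_one] at e1 e2
          simp only [vv, v]
          rw [← e1, ← e2]
          have h3 : wV s.1 s.2 * wV t.1 t.2 * (wV p.1 p.2 * wV q.1 q.2) =
              wV p.1 p.2 * wV s.1 s.2 * wV t.1 t.2 * wV q.1 q.2 := by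
            rw [hform (q := s) hp, mul_assoc (wV s.1 s.2) (wV p.1 p.2), hform (q := t) hp]
            simp only [mul_assoc]
          rw [h3]
          noncomm_ring
        -- Products involving a zero mode have no constant term, so the twist does not change them.
        have e' : twist d r (comm (vvL p q) (vvL s t)) = comm (vvL p q) (vvL s t) := by
          rw [twist_eq, e, map_add, map_smul, map_smul, pi2_vvL, pi2_vvL, hvev (Or.inl hp),
            hvev (Or.inl hp)]
          simp
        exact (lie_eq_twist _ _).trans (e'.trans e)
      refine LinearMap.mem_ker.mp (Lr_induction (W := LinearMap.ker
        ((LieModule.toEnd ℂ (Lr d r) (Mr d r)).toLinearMap.flip w ∘ₗ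
          (LieModule.toEnd ℂ (Lr d r) (Lr d r) (vvr r p q)))) (fun s t => ?_) ?_ x)
      · change ⁅⁅vvr r p q, vvr r s t⁆, w⁆ = 0
        rw [hbr p q s t hp, add_lie, smul_lie, smul_lie, hw _ _ hp, hw _ _ hp]
        simp
      · change ⁅⁅vvr r p q, oneR d r⁆, w⁆ = 0
        rw [lie_lie, one_lie, one_lie, sub_self]
  simp only [Submodule.mem_iInf, LinearMap.mem_ker, LieModule.toEnd_apply_apply] at key
  rcases h with h | h
  · exact key m p q h
  · rw [vvr_comm, hvev (Or.inr h), hvev (Or.inl h), sub_self, zero_smul, add_zero]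
    exact key m q p h

/-! ## The semilinear endomorphisms of `M_r` -/

/-- The action of `U(𝓛_r)` on `M_r` twisted by `modeLie r g`. -/
def twistAct {d : ℕ} (r : ℂ) (g : Osc d ↪ Osc d) :
    UniversalEnvelopingAlgebra ℂ (Lr d r) →ₐ[ℂ] Module.End ℂ (Mr d r) :=
  UniversalEnvelopingAlgebra.lift ℂ ((LieModule.toEnd ℂ (Lr d r) (Mr d r)).comp (modeLie r g))

theorem twistAct_ι {d : ℕ} {r : ℂ} (g : Osc d ↪ Osc d) (x : Lr d r) (m : Mr d r) :
    twistAct r g (UniversalEnvelopingAlgebra.ι ℂ x) m = ⁅modeLie r g x, m⁆ := by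
  rw [twistAct, UniversalEnvelopingAlgebra.lift_ι_apply]
  rfl

/-- The coordinate on the one-dimensional module `ℂ 1`. -/
def vacCoord (d : ℕ) (r : ℂ) : Vac d r →ₗ[ℂ] ℂ := (LinearMap.id : ℂ →ₗ[ℂ] ℂ)

open scoped TensorProduct

/-- The map `u ⊗ z ↦ z u 1` for the action twisted by `modeLie r g`. -/
def twistEval {d : ℕ} (r : ℂ) (g : Osc d ↪ Osc d) :
    UniversalEnvelopingAlgebra ℂ (Lr d r) ⊗[ℂ] Vac d r →ₗ[ℂ] Mr d r :=
  TensorProduct.lift ((LinearMap.lsmul ℂ (Mr d r)).flip.compl₁₂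
    (LinearMap.applyₗ (vacuum d r) ∘ₗ (twistAct r g).toLinearMap) (vacCoord d r))

theorem twistEval_tmul {d : ℕ} {r : ℂ} (g : Osc d ↪ Osc d)
    (u : UniversalEnvelopingAlgebra ℂ (Lr d r)) (z : Vac d r) :
    twistEval r g (u ⊗ₜ[ℂ] z) = vacCoord d r z • twistAct r g u (vacuum d r) := by
  rw [twistEval, TensorProduct.lift.tmul]
  rfl

theorem twistEval_smul {d : ℕ} {r : ℂ} (g : Osc d ↪ Osc d)
    (u : UniversalEnvelopingAlgebra ℂ (Lr d r))
    (t : UniversalEnvelopingAlgebra ℂ (Lr d r) ⊗[ℂ] Vac d r) :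
    twistEval r g (u • t) = twistAct r g u (twistEval r g t) := by
  induction t with
  | zero => simp
  | add x y hx hy => rw [smul_add, map_add, hx, hy, map_add, map_add]
  | tmul a z =>
    rw [TensorProduct.smul_tmul', smul_eq_mul, twistEval_tmul, twistEval_tmul, map_mul,
      Module.End.mul_apply, map_smul]

/-- The twist preserves `𝓛_r⁺` and its scalar part, so under the twisted action the vacuum still
satisfies the relations that define `M_r`. This makes `twistEval` vanish on the balancing relations.
-/
theorem twistAct_plus {d : ℕ} {r : ℂ} (g : Osc d ↪ Osc d)
    (a : UniversalEnvelopingAlgebra ℂ (LrPlus d r)) (z : Vac d r) :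
    vacCoord d r z • twistAct r g (envIncl (LrPlus d r) a) (vacuum d r) =
      vacCoord d r (envAct (LrPlus d r) (Vac d r) a z) • vacuum d r := by
  let S : Subalgebra ℂ (UniversalEnvelopingAlgebra ℂ (LrPlus d r)) :=
    { carrier := {a | ∀ z : Vac d r,
        vacCoord d r z • twistAct r g (envIncl (LrPlus d r) a) (vacuum d r) =
          vacCoord d r (envAct (LrPlus d r) (Vac d r) a z) • vacuum d r}
      mul_mem' := fun {a b} ha hb z => by
        rw [map_mul, map_mul, map_mul, Module.End.mul_apply, Module.End.mul_apply, ← ha,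
          ← map_smul, hb, map_smul]
      add_mem' := fun {a b} ha hb z => by
        rw [map_add, map_add, map_add, LinearMap.add_apply, LinearMap.add_apply, smul_add, ha, hb,
          map_add, add_smul]
      algebraMap_mem' := fun t z => by
        rw [AlgHom.commutes, AlgHom.commutes, AlgHom.commutes, Module.algebraMap_end_apply,
          Module.algebraMap_end_apply, map_smul, smul_comm, smul_assoc] }
  refine env_adjoin S (fun x z => ?_) a z
  rw [envAct_ι, envIncl, UniversalEnvelopingAlgebra.lift_ι_apply]
  change vacCoord d r z • twistAct r g (UniversalEnvelopingAlgebra.ι ℂ (x : Lr d r))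
    (vacuum d r) = (scalarPart d r x * vacCoord d r z) • vacuum d r
  rw [twistAct_ι, lie_vacuum (modeLie_mem_plus g x.2), scalarPart_modeLie, smul_smul, mul_comm]

theorem balancing_le_ker {d : ℕ} (r : ℂ) (g : Osc d ↪ Osc d) :
    (balancing (LrPlus d r) (Vac d r)).restrictScalars ℂ ≤ LinearMap.ker (twistEval r g) := by
  intro t ht
  rw [Submodule.restrictScalars_mem] at ht
  rw [LinearMap.mem_ker]
  induction ht using Submodule.span_induction with
  | mem t ht =>
    obtain ⟨u, a, n, rfl⟩ := ht
    rw [map_sub, twistEval_tmul, twistEval_tmul, map_mul, Module.End.mul_apply, ← map_smul,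
      twistAct_plus, map_smul, sub_self]
  | zero => exact map_zero _
  | add x y _ _ hx hy => rw [map_add, hx, hy, add_zero]
  | smul u x _ hx => rw [twistEval_smul, hx, map_zero]

/-- The endomorphism of `M_r` that fixes the vacuum and is semilinear along `modeLie r g`. -/
def modeMr {d : ℕ} (r : ℂ) (g : Osc d ↪ Osc d) : Mr d r →ₗ[ℂ] Mr d r :=
  Submodule.liftQ _ (twistEval r g) (balancing_le_ker r g) ∘ₗ
    (Submodule.Quotient.restrictScalarsEquiv ℂ
      (balancing (LrPlus d r) (Vac d r))).symm.toLinearMap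

theorem modeMr_mk {d : ℕ} {r : ℂ} (g : Osc d ↪ Osc d)
    (t : UniversalEnvelopingAlgebra ℂ (Lr d r) ⊗[ℂ] Vac d r) :
    modeMr r g (Submodule.Quotient.mk t : Mr d r) = twistEval r g t := rfl

theorem modeMr_vacuum {d : ℕ} {r : ℂ} (g : Osc d ↪ Osc d) :
    modeMr r g (vacuum d r) = vacuum d r := by
  refine (twistEval_tmul g 1 (vacGen d r)).trans ?_
  rw [map_one, Module.End.one_apply]
  exact one_smul ℂ _

theorem modeMr_lie {d : ℕ} {r : ℂ} (g : Osc d ↪ Osc d) (x : Lr d r) (m : Mr d r) :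
    modeMr r g ⁅x, m⁆ = ⁅modeLie r g x, modeMr r g m⁆ := by
  obtain ⟨t, rfl⟩ := Submodule.Quotient.mk_surjective _ m
  rw [modeMr_mk, ← twistAct_ι, ← twistEval_smul]
  rfl

theorem modeMr_vvr {d : ℕ} {r : ℂ} (g : Osc d ↪ Osc d) (p q : Gen d) (m : Mr d r) :
    modeMr r g ⁅vvr r p q, m⁆ =
      (modeCoef g p * modeCoef g q) • ⁅vvr r (modeMap g p) (modeMap g q), modeMr r g m⁆ := by
  rw [modeMr_lie, modeLie_vvr, smul_lie]

/-- A subspace of `M_r` which contains the vacuum and is stable under the `v_p v_q` is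
everything. -/
theorem Mr_induction {d : ℕ} {r : ℂ} {W : Submodule ℂ (Mr d r)} (h0 : vacuum d r ∈ W)
    (h : ∀ p q : Gen d, ∀ w ∈ W, ⁅vvr r p q, w⁆ ∈ W) (m : Mr d r) : m ∈ W :=
  Mr_top_of_lie h0 (fun x w hw => lie_mem_of_vvr hw (fun p q => h p q w hw) x) m

theorem modeMr_comp {d : ℕ} {r : ℂ} (g h : Osc d ↪ Osc d) (m : Mr d r) :
    modeMr r g (modeMr r h m) = modeMr r (h.trans g) m := by
  refine Mr_induction (W := LinearMap.eqLocus (modeMr r g ∘ₗ modeMr r h) (modeMr r (h.trans g)))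
    ?_ (fun p q w hw => ?_) m
  · change modeMr r g (modeMr r h _) = _
    simp only [modeMr_vacuum]
  · change modeMr r g (modeMr r h _) = _
    replace hw : modeMr r g (modeMr r h w) = modeMr r (h.trans g) w := hw
    rw [modeMr_vvr, map_smul, modeMr_vvr, modeMr_vvr, hw, smul_smul, mul_mul_mul_comm,
      modeCoef_comp, modeCoef_comp, Function.Embedding.coe_trans]
    -- `modeMap` need not compose on zero modes, but there both coefficients vanish.
    by_cases hp : p.2 = 0
    · rw [modeCoef_of_zero _ hp, zero_mul, zero_smul, zero_smul]
    by_cases hq : q.2 = 0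
    · rw [modeCoef_of_zero _ hq, mul_zero, zero_smul, zero_smul]
    rw [modeMap_comp _ _ hp, modeMap_comp _ _ hq]

/-- The endomorphism of `𝓛_r` for the identity injection is not the identity: it kills zero modes.
On `M_r` nothing is lost, because they act as zero. -/
theorem modeMr_id {d : ℕ} {r : ℂ} (m : Mr d r) :
    modeMr r (Function.Embedding.refl (Osc d)) m = m := by
  refine Mr_induction (W := LinearMap.eqLocus (modeMr r (Function.Embedding.refl (Osc d)))
    LinearMap.id) (modeMr_vacuum _) (fun p q w hw => ?_) m
  replace hw : modeMr r (Function.Embedding.refl (Osc d)) w = w := hw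
  change modeMr r (Function.Embedding.refl (Osc d)) ⁅vvr r p q, w⁆ = ⁅vvr r p q, w⁆
  have e : ⇑(Function.Embedding.refl (Osc d)) = id := rfl
  by_cases hp : p.2 = 0
  · rw [zeroMode_lie (Or.inl hp), map_zero]
  by_cases hq : q.2 = 0
  · rw [zeroMode_lie (Or.inr hq), map_zero]
  rw [modeMr_vvr, hw, e, modeCoef_id hp, modeCoef_id hq, modeMap_id hp, modeMap_id hq, one_mul,
    one_smul]

/-! ### Finite dependence and injectivity -/

/-- On a given vector, `modeMr r g` depends only on the values of `g` on a finite set. -/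
theorem modeMr_local {d : ℕ} {r : ℂ} (m : Mr d r) :
    ∃ F : Finset (Osc d), ∀ g h : Osc d ↪ Osc d, (∀ s ∈ F, g s = h s) →
      modeMr r g m = modeMr r h m := by
  classical
  let W : Submodule ℂ (Mr d r) :=
    { carrier := {m | ∃ F : Finset (Osc d), ∀ g h : Osc d ↪ Osc d, (∀ s ∈ F, g s = h s) →
        modeMr r g m = modeMr r h m}
      zero_mem' := ⟨∅, fun g h _ => by rw [map_zero, map_zero]⟩
      add_mem' := by
        rintro x y ⟨F, hF⟩ ⟨F', hF'⟩
        refine ⟨F ∪ F', fun g h e => ?_⟩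
        rw [map_add, map_add, hF g h fun s hs => e s (Finset.mem_union_left _ hs),
          hF' g h fun s hs => e s (Finset.mem_union_right _ hs)]
      smul_mem' := by
        rintro t x ⟨F, hF⟩
        exact ⟨F, fun g h e => by rw [map_smul, map_smul, hF g h e]⟩ }
  refine Mr_induction (W := W) ⟨∅, fun g h _ => by rw [modeMr_vacuum, modeMr_vacuum]⟩ ?_ m
  rintro p q w ⟨F, hF⟩
  -- Applying `v_p v_q` brings in at most two further labels.
  refine ⟨insert (oscOf p) (insert (oscOf q) F), fun g h e => ?_⟩
  have hmap : ∀ {p : Gen d}, g (oscOf p) = h (oscOf p) → modeMap g p = modeMap h p :=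
    fun {p} e => by rw [modeMap, modeMap, e]
  have hcoef : ∀ {p : Gen d}, g (oscOf p) = h (oscOf p) → modeCoef g p = modeCoef h p :=
    fun {p} e => by rw [modeCoef, modeCoef, hmap e]
  have hp : g (oscOf p) = h (oscOf p) := e _ (by simp)
  have hq : g (oscOf q) = h (oscOf q) := e _ (by simp)
  rw [modeMr_vvr, modeMr_vvr, hmap hp, hmap hq, hcoef hp, hcoef hq,
    hF g h fun s hs => e s (by simp [hs])]

/-- A non-surjective injection has no inverse to act with. On a single vector, however, it can be
replaced by a permutation, which acts invertibly by functoriality. -/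
theorem modeMr_injective {d : ℕ} (r : ℂ) (g : Osc d ↪ Osc d) :
    Function.Injective (modeMr r g) := by
  rw [← LinearMap.ker_eq_bot, LinearMap.ker_eq_bot']
  intro m hm
  obtain ⟨F, hF⟩ := modeMr_local m
  -- An injection defined on a finite subset of an infinite set extends to a permutation. For `d =
  -- 0` there are no labels at all.
  obtain ⟨θ, hθ⟩ : ∃ θ : Osc d ≃ Osc d, ∀ s : (F : Set (Osc d)), θ s = g s := by
    rcases isEmpty_or_nonempty (Osc d) with hE | ⟨⟨i, -⟩⟩
    · exact ⟨Equiv.refl _, fun s => hE.elim s⟩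
    · have : Nonempty (Fin d) := ⟨i⟩
      refine Cardinal.extend_function_of_lt ((Function.Embedding.subtype _).trans g) ?_
        ⟨Equiv.refl _⟩
      exact (Cardinal.lt_aleph0_of_finite _).trans_le (Cardinal.aleph0_le_mk _)
  rw [hF g θ.toEmbedding fun s hs => (hθ ⟨s, hs⟩).symm] at hm
  have h := modeMr_comp θ.symm.toEmbedding θ.toEmbedding m
  have e : θ.toEmbedding.trans θ.symm.toEmbedding = Function.Embedding.refl _ := by
    ext1 s
    exact θ.symm_apply_apply s
  rw [hm, map_zero, e, modeMr_id] at h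
  exact h.symm

/-! ## The comparison of `M_r` and `M_r^{(1)}` -/

/-- Stability under the `v^i(m) v^i(n)` is stability under the Lie algebra they generate. -/
theorem lie_mem_of_LrSub {d : ℕ} {r : ℂ} {i : Fin d} {W : Submodule ℂ (Mr d r)}
    (h : ∀ m n : ℤ, ∀ w ∈ W, ⁅vvr r (i, m) (i, n), w⁆ ∈ W) {x : Lr d r} (hx : x ∈ LrSub r i) :
    ∀ w ∈ W, ⁅x, w⁆ ∈ W := by
  induction hx using LieSubalgebra.lieSpan_induction with
  | mem x hx =>
    obtain ⟨m, n, -, rfl⟩ := hx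
    exact h m n
  | zero => exact fun w _ => by rw [zero_lie]; exact W.zero_mem
  | add x y _ _ hx hy => exact fun w hw => by rw [add_lie]; exact W.add_mem (hx w hw) (hy w hw)
  | smul t x _ hx => exact fun w hw => by rw [smul_lie]; exact W.smul_mem t (hx w hw)
  | lie x y _ _ hx hy =>
    exact fun w hw => by rw [lie_lie]; exact W.sub_mem (hx _ (hy w hw)) (hy _ (hx w hw))

/-- The generators only include `m ≤ n`; the opposite order differs by a multiple of `1`, which acts
as a scalar on `M_r`. -/
theorem vvr_lie_mem {d : ℕ} {r : ℂ} {i : Fin d} {W : Submodule ℂ (Mr d r)}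
    (h : ∀ x ∈ LrSub r i, ∀ w ∈ W, ⁅x, w⁆ ∈ W) {p q : Gen d} (hp : p.1 = i) (hq : q.1 = i)
    {w : Mr d r} (hw : w ∈ W) : ⁅vvr r p q, w⁆ ∈ W := by
  obtain ⟨_, m⟩ := p
  obtain ⟨_, n⟩ := q
  obtain rfl := hp
  obtain rfl := hq
  rcases le_total m n with hmn | hmn
  · exact h _ (LieSubalgebra.subset_lieSpan ⟨m, n, hmn, rfl⟩) w hw
  · rw [vvr_comm, add_lie, smul_lie, one_lie]
    exact W.add_mem (h _ (LieSubalgebra.subset_lieSpan ⟨n, m, hmn, rfl⟩) w hw)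
      (W.smul_mem _ hw)

/-! ### Folding all labels onto a single index -/

/-- An injection of labels with image the labels `(i, k)`, `k ∈ ℕ`. -/
structure IsFold {d : ℕ} (i : Fin d) (g : Osc d ↪ Osc d) : Prop where
  fst_eq : ∀ s, (g s).1 = i
  surj : ∀ k, ∃ s, g s = (i, k)

/-- `Osc d` is countably infinite as soon as there is an index, so an enumeration of it by `ℕ` can
be used as the second coordinate. -/
theorem exists_isFold {d : ℕ} (i : Fin d) : ∃ g : Osc d ↪ Osc d, IsFold i g := by
  have : Nonempty (Fin d) := ⟨i⟩
  obtain ⟨e⟩ : Nonempty (Osc d ≃ ℕ) := nonempty_equiv_of_countable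
  refine ⟨⟨fun s => (i, e s), fun s t h => e.injective (Prod.mk.inj h).2⟩, fun s => rfl,
    fun k => ⟨e.symm k, ?_⟩⟩
  exact Prod.ext rfl (e.apply_symm_apply k)

theorem IsFold.exists_modeMap {d : ℕ} {i : Fin d} {g : Osc d ↪ Osc d} (hg : IsFold i g) {m : ℤ}
    (hm : m ≠ 0) : ∃ p : Gen d, p.2 ≠ 0 ∧ modeMap g p = (i, m) := by
  -- The mode `m` belongs to the pair numbered `|m| - 1`; the preimage is the mode of the pair `s`
  -- with the sign of `m`.
  obtain ⟨s, hs⟩ := hg.surj (m.natAbs - 1)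
  have h : ∀ n : ℤ, n ≠ 0 → (n < 0 ∧ n.sign = -1) ∨ (0 < n ∧ n.sign = 1) := fun n hn =>
    (lt_or_gt_of_ne hn).imp (fun h => ⟨h, Int.sign_eq_neg_one_of_neg h⟩)
      fun h => ⟨h, Int.sign_eq_one_of_pos h⟩
  have h1 : m.sign * (s.2 + 1) ≠ 0 :=
    mul_ne_zero (fun h => hm (Int.sign_eq_zero_iff_zero.mp h)) (by omega)
  have h2 : oscOf ((s.1, m.sign * (s.2 + 1)) : Gen d) = s := by
    refine Prod.ext rfl ?_
    simp only [oscOf, Int.natAbs_mul, Int.natAbs_sign_of_ne_zero hm]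
    omega
  refine ⟨(s.1, m.sign * (s.2 + 1)), h1, ?_⟩
  have h3 : ((m.sign * ((s.2 : ℤ) + 1)).sign) = m.sign := by
    rw [Int.sign_mul, Int.sign_sign, Int.sign_eq_one_of_pos (by omega : (0 : ℤ) < s.2 + 1), mul_one]
  rw [modeMap, h2, hs]
  refine Prod.ext rfl ?_
  simp only [h3]
  rcases h m hm with ⟨h4, h5⟩ | ⟨h4, h5⟩ <;> rw [h5] <;> omega

/-- The image of an `𝓛_r`-submodule of `M_r` is stable under the subalgebra of the fold. -/
theorem IsFold.lie_map {d : ℕ} {r : ℂ} {i : Fin d} {g : Osc d ↪ Osc d} (hg : IsFold i g)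
    (N : LieSubmodule ℂ (Lr d r) (Mr d r)) {x : Lr d r} (hx : x ∈ LrSub r i) :
    ∀ w ∈ N.toSubmodule.map (modeMr r g), ⁅x, w⁆ ∈ N.toSubmodule.map (modeMr r g) := by
  refine lie_mem_of_LrSub (fun m n => ?_) hx
  rintro _ ⟨w, hw, rfl⟩
  -- A product with a zero mode is not reached by the fold, but it acts as zero. All others are
  -- reached up to an invertible coefficient.
  by_cases hm : m = 0
  · rw [zeroMode_lie (Or.inl hm)]
    exact Submodule.zero_mem _
  by_cases hn : n = 0
  · rw [zeroMode_lie (Or.inr hn)]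
    exact Submodule.zero_mem _
  obtain ⟨p, hp, ep⟩ := hg.exists_modeMap hm
  obtain ⟨q, hq, eq⟩ := hg.exists_modeMap hn
  have h := modeMr_vvr g p q w
  rw [ep, eq] at h
  rw [← inv_smul_smul₀ (mul_ne_zero (modeCoef_ne_zero g hp) (modeCoef_ne_zero g hq))
    ⁅vvr r (i, m) (i, n), modeMr r g w⁆, ← h]
  exact Submodule.smul_mem _ _ ⟨_, N.lie_mem hw, rfl⟩

/-- Both sides are generated from the vacuum. The fold turns every `v_p v_q` into a multiple of a
product of index `i`; conversely its range is stable under `LrSub r i` by `IsFold.lie_map`. -/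
theorem IsFold.range_eq {d : ℕ} {r : ℂ} {i : Fin d} {g : Osc d ↪ Osc d} (hg : IsFold i g) :
    LinearMap.range (modeMr r g) = (envSpan (LrSub r i) (vacuum d r)).toSubmodule := by
  apply le_antisymm
  · rintro _ ⟨m, rfl⟩
    refine Mr_induction (W := (envSpan (LrSub r i) (vacuum d r)).toSubmodule.comap (modeMr r g))
      ?_ (fun p q w hw => ?_) m
    · change modeMr r g (vacuum d r) ∈ envSpan (LrSub r i) (vacuum d r)
      rw [modeMr_vacuum]
      refine ⟨1, ?_⟩
      change envAct (LrSub r i) (Mr d r) 1 (vacuum d r) = vacuum d r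
      rw [map_one, Module.End.one_apply]
    · rw [Submodule.mem_comap] at hw ⊢
      rw [modeMr_vvr]
      exact Submodule.smul_mem _ _ (vvr_lie_mem (fun x hx w hw =>
        (envSpan (LrSub r i) (vacuum d r)).lie_mem (x := (⟨x, hx⟩ : LrSub r i)) hw)
        (hg.fst_eq _) (hg.fst_eq _) hw)
  · rintro _ ⟨u, rfl⟩
    rw [← Submodule.map_top]
    refine env_stable (envAct (LrSub r i) (Mr d r)) _ (fun x w hw => ?_) u _
      ⟨vacuum d r, trivial, modeMr_vacuum g⟩
    rw [envAct_ι]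
    exact hg.lie_map ⊤ x.2 w hw

/-- The isomorphism `M_r ≃ M_r^{(i)}` of vector spaces induced by a fold. -/
def IsFold.equiv {d : ℕ} (r : ℂ) {i : Fin d} {g : Osc d ↪ Osc d} (hg : IsFold i g) :
    Mr d r ≃ₗ[ℂ] envSpan (LrSub r i) (vacuum d r) :=
  (LinearEquiv.ofInjective (modeMr r g) (modeMr_injective r g)).trans
    (LinearEquiv.ofEq _ _ hg.range_eq)

/-- The isomorphism of the lattices of submodules of `M_r` and `M_r^{(i)}` induced by a fold. -/
def IsFold.orderIso {d : ℕ} (r : ℂ) {i : Fin d} {g : Osc d ↪ Osc d} (hg : IsFold i g) :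
    LieSubmodule ℂ (Lr d r) (Mr d r) ≃o
      LieSubmodule ℂ (LrSub r i) (envSpan (LrSub r i) (vacuum d r)) where
  toFun N :=
    { N.toSubmodule.map (hg.equiv r).toLinearMap with
      lie_mem := by
        rintro x _ ⟨n, hn, rfl⟩
        obtain ⟨n', hn', e⟩ := hg.lie_map N x.2 _ ⟨n, hn, rfl⟩
        exact ⟨n', hn', Subtype.ext e⟩ }
  invFun N :=
    { N.toSubmodule.comap (hg.equiv r).toLinearMap with
      lie_mem := by
        intro x m hm
        -- Stability under the whole of `𝓛_r` need only be tested on the `v_p v_q`, including those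
        -- with mixed indices. The fold carries each to a multiple of a product of index `i`, under
        -- which `N` is stable.
        refine lie_mem_of_vvr (W := N.toSubmodule.comap (hg.equiv r).toLinearMap) hm
          (fun p q => ?_) x
        have hst : ∀ x ∈ LrSub r i, ∀ w ∈ N.toSubmodule.map
            (envSpan (LrSub r i) (vacuum d r)).toSubmodule.subtype, ⁅x, w⁆ ∈ N.toSubmodule.map
            (envSpan (LrSub r i) (vacuum d r)).toSubmodule.subtype := by
          rintro x hx _ ⟨w, hw, rfl⟩
          exact ⟨_, N.lie_mem (x := ⟨x, hx⟩) hw, rfl⟩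
        obtain ⟨y, hy, e⟩ := Submodule.smul_mem _ (modeCoef g p * modeCoef g q)
          (vvr_lie_mem hst (p := modeMap g p) (q := modeMap g q) (hg.fst_eq _) (hg.fst_eq _)
            ⟨_, hm, rfl⟩)
        have e' : y = hg.equiv r ⁅vvr r p q, m⁆ := Subtype.ext (e.trans (modeMr_vvr g p q m).symm)
        change hg.equiv r ⁅vvr r p q, m⁆ ∈ N
        rw [← e']
        exact hy }
  left_inv N := by
    refine LieSubmodule.toSubmodule_injective ?_
    exact Submodule.comap_map_eq_of_injective (hg.equiv r).injective _
  right_inv N := by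
    refine LieSubmodule.toSubmodule_injective ?_
    exact Submodule.map_comap_eq_of_surjective (hg.equiv r).surjective _
  map_rel_iff' {N N'} := by
    exact Submodule.map_le_map_iff_of_injective (f := (hg.equiv r).toLinearMap)
      (hg.equiv r).injective N.toSubmodule N'.toSubmodule

end

end AshiharaMiyamoto

theorem proposition4p1 (d : ℕ) (hd : 2 ≤ d) (r : ℂ) :
    LieModule.IsIrreducible ℂ (AshiharaMiyamoto.Lr d r) (AshiharaMiyamoto.Mr d r) ↔
      LieModule.IsIrreducible ℂ (AshiharaMiyamoto.LrOne d hd r)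
        (AshiharaMiyamoto.MrOne d hd r) := by
  obtain ⟨g, hg⟩ := AshiharaMiyamoto.exists_isFold (⟨0, by omega⟩ : Fin d)
  -- Irreducibility means that the lattice of Lie submodules is a simple order, so an order
  -- isomorphism transports it both ways.
  exact (hg.orderIso r).isSimpleOrder_iff
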